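/- **Setting.** Let $K\ge 1$ and $T$ be integers with $K\le 2T+1$. Consider a random walk on the transient nodes $[K]=\{1,\dots,K\}$ and one absorbing node $*$: from any transient node the walk moves to each transient node (itself included) with probability $p=\frac1{2K}$ and to $*$ with probability $1-Kp=\frac12$. In each epoch $t=1,\dots,T$ edge lengths $l^{(t)}_{ij}\in\{0,1\}$ ($i\in[K]$, $j\in[K]\cup\{*\}$) are drawn, the player chooses a node $J_t\in[K]$ without seeing them, and observes the trajectory $X_0=J_t,L_1,X_1,L_2,\dots,X_H=*$ of a random walk started at $J_t$, where $L_s$ is the length of the edge from $X_{s-1}$ to $X_s$. A policy $\pi$ chooses (the law of) $J_t$ as an arbitrary function of the nodes played and the trajectories observed in the epochs before $t$. Write $l_{t,i}$ for the expected hitting time of $*$ from $i$ in the graph of epoch $t$, that is, the expectation over the walk, for the given lengths of epoch $t$, of $L_1+\dots+L_H$ when $X_0=i$. The adversarial regret against node $k$ is $$\mathrm{Reg}^{\mathrm{adv}}_k(T)=\sum_{t=1}^T\left(l_{t,k}-l_{t,J_t}\right).$$ **Instances.** Put $\epsilon=\frac{1}{4\sqrt2}\,\frac{K-1}{K}\sqrt{\frac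 KT}$ (read as $0$ if $T=0$). All edge lengths are independent, over edges and epochs, and independent of the other randomness. In the instance $\mathfrak J_0$ they are all Bernoulli$\left(\frac12\right)$. In the instance $\mathfrak J_k$, $1\le k\le K$, the edge from $k$ to $*$ has a Bernoulli$\left(\frac12+\frac{\epsilon}{1-Kp}\right)$ length in every epoch, and all other edge lengths are Bernoulli$\left(\frac12\right)$. (The condition $K\le 2T+1$ says exactly that $\frac12+\frac{\epsilon}{1-Kp}\le1$.) **Theorem.** For every policy $\pi$ there is $k\in\{1,\dots,K\}$ such that $\mathrm{Reg}^{\mathrm{adv}}_k(T)$ is integrable in the instance $\mathfrak J_k$ and $$\mathbb E_{\mathfrak J_k,\pi}\left[\mathrm{Reg}^{\mathrm{adv}}_k(T)\right]\ \ge\ \frac1{8\sqrt2}\left(\frac{K-1}{K}\right)^2\sqrt{KT},$$ and, if $K\ge 6$, moreover $$\mathbb E_{\mathfrak J_k,\pi}\left[\mathrm{Reg}^{\mathrm{adv}}_k(T)\right]\ \ge\ \frac1{8\sqrt2}\sqrt{KT}.$$ -/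

import Mathlib

open scoped ENNReal NNReal

/-! Bandits with random-walk feedback.  The nodes are `Fin K` (transient) and one absorbing node,
written `none : Option (Fin K)`. -/

namespace RandomWalkBandit

/-! ### The random walk -/

/-- `pathWeight M i [x₁, …, xₙ]` is the probability that the walk with transition matrix `M` among
the transient nodes, started at `i`, visits exactly `i, x₁, …, xₙ` in this order and then steps to
the absorbing node.  From `i` the walk is absorbed with probability `1 - ∑ j, M i j`. -/
noncomputable def pathWeight {K : ℕ} (M : Fin K → Fin K → ℝ≥0∞) : Fin K → List (Fin K) → ℝ≥0∞
  | i, [] => 1 - ∑ j, M i j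
  | i, x :: path => M i x * pathWeight M x path

/-- The common transition probability between any two transient nodes (equal or not). -/
noncomputable def stepProb (K : ℕ) : ℝ := 1 / (2 * K)

/-- All transition probabilities among transient nodes are equal. -/
noncomputable def transition (K : ℕ) (_ _ : Fin K) : ℝ≥0∞ := ENNReal.ofReal (stepProb K)

theorem sum_transition {K : ℕ} (i : Fin K) : ∑ j, transition K i j = 2⁻¹ := by
  have hK : (0 : ℝ) < K := by exact_mod_cast i.pos
  have h : (K : ℝ≥0∞) = ENNReal.ofReal K := by simp
  simp only [transition, Finset.sum_const, Finset.card_univ, Fintype.card_fin, nsmul_eq_mul]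
  rw [h, ← ENNReal.ofReal_mul hK.le, stepProb]
  have : (K : ℝ) * (1 / (2 * K)) = 2⁻¹ := by field_simp
  rw [this, ENNReal.ofReal_inv_of_pos (by norm_num)]
  simp

theorem tsum_pathWeight_length {K : ℕ} (n : ℕ) (i : Fin K) :
    ∑' path : {l : List (Fin K) // l.length = n}, pathWeight (transition K) i path.1
      = 2⁻¹ ^ (n + 1) := by
  induction n generalizing i with
  | zero =>
    rw [tsum_eq_single (⟨[], rfl⟩ : {l : List (Fin K) // l.length = 0})
      (fun v hv => absurd (Subtype.ext (List.eq_nil_of_length_eq_zero v.2)) hv)]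
    simp [pathWeight, sum_transition]
  | succ n ih =>
    let e : (Σ _ : Fin K, {l : List (Fin K) // l.length = n}) ≃
        {l : List (Fin K) // l.length = n + 1} :=
      { toFun := fun v => ⟨v.1 :: v.2.1, by simp [v.2.2]⟩
        invFun := fun v => match v with
          | ⟨x :: path, h⟩ => ⟨x, path, by simpa using h⟩
        left_inv := fun v => rfl
        right_inv := fun v => match v with
          | ⟨x :: path, h⟩ => rfl }
    rw [← e.tsum_eq, ENNReal.tsum_sigma']
    have h : ∀ (x : Fin K) (v : {l : List (Fin K) // l.length = n}),
        pathWeight (transition K) i (e ⟨x, v⟩).1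
          = transition K i x * pathWeight (transition K) x v.1 := fun _ _ => rfl
    simp only [h, ENNReal.tsum_mul_left, ih]
    rw [tsum_fintype, ← Finset.sum_mul, sum_transition, ← pow_succ']

theorem tsum_pathWeight_mul {K : ℕ} (f : ℕ → ℝ≥0∞) (i : Fin K) :
    ∑' path : List (Fin K), pathWeight (transition K) i path * f path.length
      = ∑' n : ℕ, 2⁻¹ ^ (n + 1) * f n := by
  rw [← (Equiv.sigmaFiberEquiv (List.length : List (Fin K) → ℕ)).tsum_eq, ENNReal.tsum_sigma']
  refine tsum_congr fun n => ?_
  rw [← tsum_pathWeight_length n i, ← ENNReal.tsum_mul_right]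
  refine tsum_congr fun path => ?_
  have h : (Equiv.sigmaFiberEquiv (List.length : List (Fin K) → ℕ)) ⟨n, path⟩ = path.1 := rfl
  rw [h, path.2]

theorem tsum_pathWeight {K : ℕ} (i : Fin K) :
    ∑' path : List (Fin K), pathWeight (transition K) i path = 1 := by
  have h := tsum_pathWeight_mul (fun _ => 1) i
  simp only [mul_one] at h
  rw [h]
  simp only [pow_succ', ENNReal.tsum_mul_left, ENNReal.tsum_geometric]
  rw [ENNReal.one_sub_inv_two, inv_inv, ENNReal.inv_mul_cancel] <;> simp

/-- The law of the transient nodes visited after the start, for the walk started at `i`. -/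
noncomputable def walk {K : ℕ} (i : Fin K) : PMF (List (Fin K)) :=
  ⟨pathWeight (transition K) i, by
    have h := ENNReal.summable.hasSum (f := pathWeight (transition K) i)
    rwa [tsum_pathWeight i] at h⟩

/-! ### Edge lengths and trajectories -/

/-- The edge lengths of one epoch.  The edge `(i, some j)` goes from `i` to the transient node `j`,
the edge `(i, none)` goes from `i` to the absorbing node; `true` means length `1` and `false`
means length `0`. -/
abbrev EdgeLengths (K : ℕ) : Type := Fin K × Option (Fin K) → Bool

/-- A trajectory `(L₁, X₁), (L₂, X₂), …` after its start: lengths of the edges crossed and nodes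
reached, the last node being the absorbing one. -/
abbrev Trajectory (K : ℕ) : Type := List (Bool × Option (Fin K))

/-- The trajectory along the edges with lengths `l` of the walk that starts at `i`, visits the
nodes of `path` and is then absorbed. -/
def trajectory {K : ℕ} (l : EdgeLengths K) : Fin K → List (Fin K) → Trajectory K
  | i, [] => [(l (i, none), none)]
  | i, x :: path => (l (i, some x), some x) :: trajectory l x path

/-- The hitting time of the absorbing node: the sum of the lengths of the edges crossed. -/
def hittingTime {K : ℕ} (τ : Trajectory K) : ℕ := (τ.map fun s => s.1.toNat).sum

/-- The expected hitting time, over the random walk, from `i` in the graph with lengths `l`. -/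
noncomputable def meanHittingTime {K : ℕ} (l : EdgeLengths K) (i : Fin K) : ℝ :=
  ∑' path : List (Fin K), (walk i path).toReal * (hittingTime (trajectory l i path) : ℝ)

theorem hittingTime_trajectory_le {K : ℕ} (l : EdgeLengths K) (i : Fin K) (path : List (Fin K)) :
    hittingTime (trajectory l i path) ≤ path.length + 1 := by
  induction path generalizing i with
  | nil => simpa [hittingTime, trajectory] using Bool.toNat_le _
  | cons x path ih =>
    have h1 := ih x
    have h2 := Bool.toNat_le (l (i, some x))
    simp only [hittingTime, trajectory, List.map_cons, List.sum_cons, List.length_cons] at h1 ⊢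
    omega

/-- The series that defines the expected hitting time converges. -/
theorem summable_meanHittingTime {K : ℕ} (l : EdgeLengths K) (i : Fin K) :
    Summable fun path : List (Fin K) =>
      (walk i path).toReal * (hittingTime (trajectory l i path) : ℝ) := by
  have key : ∑' path : List (Fin K), walk i path * ((path.length + 1 : ℕ) : ℝ≥0∞) ≠ ⊤ := by
    have h := tsum_pathWeight_mul (fun n => ((n + 1 : ℕ) : ℝ≥0∞)) i
    have h' : ∑' path : List (Fin K), walk i path * ((path.length + 1 : ℕ) : ℝ≥0∞)
        = ∑' n : ℕ, 2⁻¹ ^ (n + 1) * ((n + 1 : ℕ) : ℝ≥0∞) := h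
    rw [h']
    have hs : Summable fun n : ℕ => ((n + 1 : ℕ) : ℝ) ^ 1 * (1 / 2 : ℝ) ^ (n + 1) :=
      (summable_nat_add_iff 1).2
        (summable_pow_mul_geometric_of_norm_lt_one (R := ℝ) 1 (r := 1 / 2) (by norm_num))
    have e : ∀ n : ℕ, (2⁻¹ : ℝ≥0∞) ^ (n + 1) * ((n + 1 : ℕ) : ℝ≥0∞)
        = ENNReal.ofReal (((n + 1 : ℕ) : ℝ) ^ 1 * (1 / 2 : ℝ) ^ (n + 1)) := by
      intro n
      rw [pow_one, mul_comm, ENNReal.ofReal_mul (by positivity), ENNReal.ofReal_natCast,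
        ENNReal.ofReal_pow (by norm_num), one_div, ENNReal.ofReal_inv_of_pos (by norm_num)]
      simp
    simp only [e]
    exact hs.tsum_ofReal_ne_top
  refine Summable.of_nonneg_of_le (fun _ => by positivity) (fun path => ?_)
    (ENNReal.summable_toReal key)
  rw [ENNReal.toReal_mul, ENNReal.toReal_natCast]
  gcongr
  exact hittingTime_trajectory_le l i path

/-- The Bernoulli distribution with parameter `q`. -/
noncomputable def bernoulli (q : unitInterval) : PMF Bool :=
  PMF.ofFintype (fun b => ENNReal.ofReal (if b then (q : ℝ) else 1 - q)) (by
    simp only [Fintype.sum_bool, if_true, Bool.false_eq_true, if_false]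
    rw [← ENNReal.ofReal_add q.2.1 (sub_nonneg.2 q.2.2)]
    simp)

/-- Independent Bernoulli edge lengths; edge `e` has parameter `q e`. -/
noncomputable def edgeLaw {K : ℕ} (q : Fin K × Option (Fin K) → unitInterval) :
    PMF (EdgeLengths K) :=
  PMF.ofFintype (fun l => ∏ e, bernoulli (q e) (l e)) (by
    have h := Finset.prod_univ_sum (fun _ : Fin K × Option (Fin K) => (Finset.univ : Finset Bool))
      (fun e b => bernoulli (q e) b)
    rw [Fintype.piFinset_univ] at h
    rw [← h]
    refine Finset.prod_eq_one fun e _ => ?_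
    rw [← tsum_fintype (L := .unconditional _)]
    exact (bernoulli (q e)).tsum_coe)

/-! ### The interaction of a policy with an instance -/

/-- What happens in one epoch: the node that is played, the edge lengths of this epoch (not shown
to the player) and the trajectory of the walk started at the node that is played. -/
structure Epoch (K : ℕ) where
  node : Fin K
  lengths : EdgeLengths K
  traj : Trajectory K

/-- The part of an epoch that the player observes. -/
def Epoch.observed {K : ℕ} (e : Epoch K) : Fin K × Trajectory K := (e.node, e.traj)

/-- A (randomized, history-dependent) policy: the law of the next node to play, given the
observations of the past epochs, the most recent one first. -/
abbrev Policy (K : ℕ) : Type := List (Fin K × Trajectory K) → PMF (Fin K)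

/-- The joint law of the first `T` epochs (the most recent one first) when `π` is played and the
edge lengths of the epochs are independent with law `edgeLaw q`. -/
noncomputable def law {K : ℕ} (q : Fin K × Option (Fin K) → unitInterval) (π : Policy K) :
    ℕ → PMF (List (Epoch K))
  | 0 => PMF.pure []
  | T + 1 =>
    (law q π T).bind fun h =>
      (π (h.map Epoch.observed)).bind fun j =>
        (edgeLaw q).bind fun l =>
          (walk j).bind fun path => PMF.pure (⟨j, l, trajectory l j path⟩ :: h)

/-- The adversarial regret against node `k`: total expected hitting time of `k` minus that of the
nodes played, in the graphs that were actually drawn. -/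
noncomputable def regret {K : ℕ} (k : Fin K) (h : List (Epoch K)) : ℝ :=
  (h.map fun e => meanHittingTime e.lengths k - meanHittingTime e.lengths e.node).sum

/-- The expected adversarial regret of `π` against node `k` over `T` epochs. -/
noncomputable def expectedRegret {K : ℕ} (q : Fin K × Option (Fin K) → unitInterval)
    (π : Policy K) (T : ℕ) (k : Fin K) : ℝ :=
  ∑' h : List (Epoch K), (law q π T h).toReal * regret k h

/-! ### The instances -/

/-- The perturbation `ε`. -/
noncomputable def perturbation (K T : ℕ) : ℝ :=
  1 / (4 * √2) * ((K - 1) / K) * √(K / T)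

theorem perturbation_nonneg (K T : ℕ) (hK : 1 ≤ K) : 0 ≤ perturbation K T := by
  have h : (1 : ℝ) ≤ K := by exact_mod_cast hK
  have : (0 : ℝ) ≤ K - 1 := by linarith
  unfold perturbation
  positivity

theorem perturbation_div_nonneg {K T : ℕ} (hK : 1 ≤ K) :
    0 ≤ perturbation K T / (1 - K * stepProb K) := by
  have h0 : (0 : ℝ) < K := by exact_mod_cast hK
  have h2 : 1 - (K : ℝ) * stepProb K = 1 / 2 := by
    unfold stepProb; field_simp; norm_num
  rw [h2]
  have := perturbation_nonneg K T hK
  positivity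

/-- The perturbed Bernoulli parameter is at most `1` as soon as `K ≤ 2 * T + 1`. -/
theorem perturbation_div_le {K T : ℕ} (hK : 1 ≤ K) (hKT : K ≤ 2 * T + 1) :
    perturbation K T / (1 - K * stepProb K) ≤ 1 / 2 := by
  have h0 : (1 : ℝ) ≤ K := by exact_mod_cast hK
  have h1 : (K : ℝ) ≤ 2 * T + 1 := by exact_mod_cast hKT
  have h2 : 1 - (K : ℝ) * stepProb K = 1 / 2 := by
    unfold stepProb; field_simp; norm_num
  rw [h2]
  suffices h : perturbation K T ≤ 1 / 4 by linarith
  rcases Nat.eq_zero_or_pos T with rfl | hT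
  · simp [perturbation]
  have hT' : (0 : ℝ) < T := by exact_mod_cast hT
  have hs : perturbation K T ^ 2 ≤ (1 / 4) ^ 2 := by
    have e : perturbation K T ^ 2 = (K - 1) ^ 2 / (32 * (K * T)) := by
      unfold perturbation
      rw [mul_pow, mul_pow, div_pow, mul_pow, Real.sq_sqrt (by norm_num),
        Real.sq_sqrt (by positivity)]
      field_simp
      ring
    rw [e, div_le_iff₀ (by positivity)]
    nlinarith [mul_nonneg (sub_nonneg.2 h0) (sub_nonneg.2 h1)]
  exact le_of_sq_le_sq hs (by norm_num)

/-- The Bernoulli parameters of the instances `𝔍₀` (`none`) and `𝔍ₖ` (`some k`): the edge from `k`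
to the absorbing node has parameter `1/2 + ε / (1 - K p)` in `𝔍ₖ`, every other parameter is
`1/2`. -/
noncomputable def instanceParam (K T : ℕ) (hK : 1 ≤ K) (hKT : K ≤ 2 * T + 1) :
    Option (Fin K) → Fin K × Option (Fin K) → unitInterval
  | m, (i, x) =>
    if m = some i ∧ x = none then
      ⟨1 / 2 + perturbation K T / (1 - K * stepProb K), by
        have h1 := perturbation_div_nonneg (T := T) hK
        have h2 := perturbation_div_le hK hKT
        constructor <;> linarith⟩
    else ⟨1 / 2, by norm_num, by norm_num⟩

end RandomWalkBandit

/-! # A lower bound for bandits with random-walk feedback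

All rows of the transition matrix agree, so two starting nodes differ only in the first step of the
walk.  With `s = 4 ε`, so that the perturbed edge has parameter `(1 + s) / 2`, a play of a node
other than the perturbed node `k` therefore costs exactly `s / 4 = ε` in expectation, and the
expected regret is `ε` times the expected number of epochs in which `k` is not played
(`expectedRegret_eq`).  It remains to find `k` that is not played too often in the instance `𝔍ₖ`.

The player notices the perturbation only when the walk is absorbed from `k`: marginally over the
edge lengths, which are hidden, the density of an observed trajectory under `𝔍ₖ` with respect to
`𝔍₀` is `1 ± s` if the walk is absorbed from `k`, and `1` otherwise
(`expect_trajectory_perturbed`).  Each walk is absorbed from exactly one node, so over `t` epochs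
the expected numbers of walks absorbed from `k` under `𝔍₀` sum to `t` over `k`
(`sum_expectedExits`).  The probability of playing `k` in epoch `t + 1` under `𝔍ₖ` exceeds the one
under `𝔍₀` by at most half the `L¹` distance between the density of the first `t` observations
and `1`.  Two bounds for this distance are needed, because the relative entropy of one length is
`-log (1 - s ^ 2) / 2` and `s` may be close to `1`:

* for `2 T ≤ 5 K`, the distances of the single epochs add up (`expect_policy_sub_le_linear`);
* for `2 T > 5 K`, where `s ^ 2 ≤ 1 / 5`, the relative entropies add up by the chain rule, and
  Pinsker's inequality gives the distance (`expect_policy_sub_le_entropy`).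

In both cases summation over `t` and `k` gives an excess of at most `7 / 25 * T * (K - 1)`
(`sum_expectedPlays_perturbed_le`); since the numbers of plays under `𝔍₀` sum to `T`, some `k` is
not played in at least `18 / 25 * T * (K - 1) / K` epochs (`exists_expectedPlays_le`).  It matters
for the constant that epoch `t + 1` is compared through the first `t` epochs only. -/

namespace RandomWalkBandit

/-! ### Expectations of real functions under a discrete law -/

/-- The expectation of `f` under the discrete law `p`, meaningful when the series converges, for
instance when `f` is bounded on the support of `p`. -/
noncomputable def expect {α : Type*} (p : PMF α) (f : α → ℝ) : ℝ := ∑' a, (p a).toReal * f a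

/-- `f` is bounded on the support of `p`. -/
def BddOn {α : Type*} (p : PMF α) (f : α → ℝ) : Prop := ∃ C, ∀ a ∈ p.support, |f a| ≤ C

section expect

variable {α β γ : Type*} {p : PMF α} {f g : α → ℝ}

theorem summable_toReal (p : PMF α) : Summable fun a => (p a).toReal :=
  ENNReal.summable_toReal p.tsum_coe_ne_top

theorem tsum_toReal (p : PMF α) : ∑' a, (p a).toReal = 1 := by
  rw [← ENNReal.tsum_toReal_eq (fun a => p.apply_ne_top a), p.tsum_coe, ENNReal.toReal_one]

theorem toReal_mul_le {C : ℝ} (hC : ∀ a ∈ p.support, |f a| ≤ C) (a : α) :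
    ‖(p a).toReal * f a‖ ≤ (p a).toReal * C := by
  rw [norm_mul, Real.norm_eq_abs, Real.norm_eq_abs, abs_of_nonneg ENNReal.toReal_nonneg]
  by_cases ha : p a = 0
  · simp [ha]
  · exact mul_le_mul_of_nonneg_left (hC a ((p.mem_support_iff a).2 ha)) ENNReal.toReal_nonneg

theorem BddOn.summable (hf : BddOn p f) : Summable fun a => (p a).toReal * f a := by
  obtain ⟨C, hC⟩ := hf
  exact Summable.of_norm_bounded ((summable_toReal p).mul_right C) (toReal_mul_le hC)

theorem bddOn_of_le {C : ℝ} (h : ∀ a, |f a| ≤ C) : BddOn p f := ⟨C, fun a _ => h a⟩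

theorem BddOn.add (hf : BddOn p f) (hg : BddOn p g) : BddOn p fun a => f a + g a := by
  obtain ⟨C, hC⟩ := hf
  obtain ⟨D, hD⟩ := hg
  exact ⟨C + D, fun a ha => (abs_add_le _ _).trans (add_le_add (hC a ha) (hD a ha))⟩

theorem BddOn.const_mul (hf : BddOn p f) (c : ℝ) : BddOn p fun a => c * f a := by
  obtain ⟨C, hC⟩ := hf
  exact ⟨|c| * C, fun a ha => by
    rw [abs_mul]
    exact mul_le_mul_of_nonneg_left (hC a ha) (abs_nonneg c)⟩

theorem expect_add (hf : BddOn p f) (hg : BddOn p g) :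
    expect p (fun a => f a + g a) = expect p f + expect p g := by
  simp only [expect, mul_add]
  exact hf.summable.tsum_add hg.summable

theorem expect_sub (hf : BddOn p f) (hg : BddOn p g) :
    expect p (fun a => f a - g a) = expect p f - expect p g := by
  simp only [expect, mul_sub]
  exact hf.summable.tsum_sub hg.summable

theorem expect_const_mul (p : PMF α) (f : α → ℝ) (c : ℝ) :
    expect p (fun a => c * f a) = c * expect p f := by
  simp only [expect, ← tsum_mul_left]
  exact tsum_congr fun a => by ring

theorem expect_mul_const (p : PMF α) (f : α → ℝ) (c : ℝ) :
    expect p (fun a => f a * c) = expect p f * c := by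
  simp only [mul_comm _ c, expect_const_mul]

@[simp]
theorem expect_const (p : PMF α) (c : ℝ) : expect p (fun _ => c) = c := by
  simp only [expect, tsum_mul_right, tsum_toReal, one_mul]

theorem expect_mono_on (hf : BddOn p f) (hg : BddOn p g) (h : ∀ a ∈ p.support, f a ≤ g a) :
    expect p f ≤ expect p g := by
  refine hf.summable.tsum_le_tsum (fun a => ?_) hg.summable
  by_cases ha : p a = 0
  · simp [ha]
  · exact mul_le_mul_of_nonneg_left (h a ((p.mem_support_iff a).2 ha)) ENNReal.toReal_nonneg

theorem expect_mono (hf : BddOn p f) (hg : BddOn p g) (h : ∀ a, f a ≤ g a) :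
    expect p f ≤ expect p g := expect_mono_on hf hg fun a _ => h a

theorem expect_congr_on (h : ∀ a ∈ p.support, f a = g a) : expect p f = expect p g := by
  refine tsum_congr fun a => ?_
  by_cases ha : p a = 0
  · simp [ha]
  · rw [h a ((p.mem_support_iff a).2 ha)]

theorem abs_expect_le {C : ℝ} (h : ∀ a ∈ p.support, |f a| ≤ C) : |expect p f| ≤ C := by
  have hf : BddOn p f := ⟨C, h⟩
  have hc (c : ℝ) : BddOn p fun _ => c := bddOn_of_le fun _ => le_rfl
  rw [abs_le]
  constructor
  · simpa using expect_mono_on (hc (-C)) hf fun a ha => (abs_le.1 (h a ha)).1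
  · simpa using expect_mono_on hf (hc C) fun a ha => (abs_le.1 (h a ha)).2

theorem expect_pure (a : α) (f : α → ℝ) : expect (PMF.pure a) f = f a := by
  classical
  rw [expect, tsum_eq_single a fun b hb => by simp [PMF.pure_apply_of_ne _ _ hb]]
  simp

theorem expect_fintype [Fintype α] (p : PMF α) (f : α → ℝ) :
    expect p f = ∑ a, (p a).toReal * f a := tsum_fintype _

theorem bddOn_fintype [Finite α] (p : PMF α) (f : α → ℝ) : BddOn p f := by
  obtain ⟨C, hC⟩ := (Set.finite_range fun a => |f a|).bddAbove
  exact bddOn_of_le fun a => hC ⟨a, rfl⟩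

/-- The tower property. -/
theorem expect_bind {q : α → PMF β} {f : β → ℝ} (hf : BddOn (p.bind q) f) :
    expect (p.bind q) f = expect p fun a => expect (q a) f := by
  obtain ⟨C, hC⟩ := hf
  have hs : Summable fun x : β × α => (p x.2 * q x.2 x.1).toReal := by
    refine ENNReal.summable_toReal ?_
    rw [ENNReal.tsum_prod (f := fun b a => p a * q a b)]
    exact (p.bind q).tsum_coe_ne_top
  have hs' : Summable fun x : β × α => (p x.2 * q x.2 x.1).toReal * f x.1 := by
    refine Summable.of_norm_bounded (hs.mul_right C) fun x => ?_
    rw [norm_mul, Real.norm_eq_abs, Real.norm_eq_abs, abs_of_nonneg ENNReal.toReal_nonneg]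
    by_cases hx : p x.2 * q x.2 x.1 = 0
    · simp [hx]
    · refine mul_le_mul_of_nonneg_left (hC _ ?_) ENNReal.toReal_nonneg
      rw [PMF.mem_support_bind_iff]
      exact ⟨x.2, (p.mem_support_iff _).2 (left_ne_zero_of_mul hx),
        ((q x.2).mem_support_iff _).2 (right_ne_zero_of_mul hx)⟩
  have h1 : expect (p.bind q) f = ∑' b, ∑' a, (p a * q a b).toReal * f b := by
    refine tsum_congr fun b => ?_
    rw [PMF.bind_apply, ENNReal.tsum_toReal_eq fun a =>
      ENNReal.mul_ne_top (p.apply_ne_top a) ((q a).apply_ne_top b), tsum_mul_right]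
  rw [h1, Summable.tsum_comm (f := fun a b => (p a * q a b).toReal * f b)
    (by exact (Equiv.prodComm _ _).summable_iff.1 hs')]
  refine tsum_congr fun a => ?_
  simp only [expect, ← tsum_mul_left, ENNReal.toReal_mul, mul_assoc]

theorem expect_map {φ : α → β} {f : β → ℝ} (hf : BddOn (p.map φ) f) :
    expect (p.map φ) f = expect p fun a => f (φ a) := by
  rw [PMF.map, expect_bind hf]
  simp [expect_pure]

theorem expect_comm (p : PMF α) (q : PMF β) {f : α → β → ℝ} {C : ℝ} (hf : ∀ a b, |f a b| ≤ C) :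
    expect p (fun a => expect q (f a)) = expect q fun b => expect p fun a => f a b := by
  have h := congrArg (fun r => expect r fun x : α × β => f x.1 x.2)
    (PMF.bind_comm p q fun a b => PMF.pure (a, b))
  simpa [expect_bind (bddOn_of_le fun x : α × β => hf x.1 x.2), expect_pure] using h

end expect

/-! ### Histories generated by a kernel -/

section history

variable {O : Type*}

/-- The law of the history, most recent observation first, after a given number of rounds, when
the next observation is drawn from `κ` applied to the history so far. -/
noncomputable def histLaw (κ : List O → PMF O) : ℕ → PMF (List O)
  | 0 => PMF.pure []
  | n + 1 => (histLaw κ n).bind fun h => (κ h).map (· :: h)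

/-- `f` is bounded on the histories of each given length. -/
def BddPerLength (f : List O → ℝ) : Prop := ∀ n, ∃ C, ∀ h : List O, h.length = n → |f h| ≤ C

variable {κ κ₀ κ₁ : List O → PMF O} {f g : List O → ℝ} {r u : O → ℝ}

theorem length_of_mem_support_histLaw {n : ℕ} {h : List O} (hh : h ∈ (histLaw κ n).support) :
    h.length = n := by
  induction n generalizing h with
  | zero =>
    rw [histLaw, PMF.mem_support_pure_iff] at hh
    simp [hh]
  | succ n ih =>
    rw [histLaw, PMF.mem_support_bind_iff] at hh
    obtain ⟨h', hh', ho⟩ := hh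
    rw [PMF.mem_support_map_iff] at ho
    obtain ⟨o, -, rfl⟩ := ho
    simp [ih hh']

theorem BddPerLength.bddOn (hf : BddPerLength f) (κ : List O → PMF O) (n : ℕ) :
    BddOn (histLaw κ n) f := by
  obtain ⟨C, hC⟩ := hf n
  exact ⟨C, fun h hh => hC h (length_of_mem_support_histLaw hh)⟩

theorem bddPerLength_of_le {C : ℝ} (h : ∀ x, |f x| ≤ C) : BddPerLength f :=
  fun _ => ⟨C, fun x _ => h x⟩

theorem BddPerLength.add (hf : BddPerLength f) (hg : BddPerLength g) :
    BddPerLength fun h => f h + g h := fun n => by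
  obtain ⟨C, hC⟩ := hf n
  obtain ⟨D, hD⟩ := hg n
  exact ⟨C + D, fun a ha => (abs_add_le _ _).trans (add_le_add (hC a ha) (hD a ha))⟩

theorem BddPerLength.mul (hf : BddPerLength f) (hg : BddPerLength g) :
    BddPerLength fun h => f h * g h := fun n => by
  obtain ⟨C, hC⟩ := hf n
  obtain ⟨D, hD⟩ := hg n
  exact ⟨C * D, fun a ha => by
    rw [abs_mul]
    exact mul_le_mul (hC a ha) (hD a ha) (abs_nonneg _) ((abs_nonneg _).trans (hC a ha))⟩

theorem BddPerLength.abs_sub_one (hf : BddPerLength f) : BddPerLength fun h => |f h - 1| :=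
  fun n => by
    obtain ⟨C, hC⟩ := (hf.add (bddPerLength_of_le (C := 1) (f := fun _ => -1) (by simp))) n
    exact ⟨C, fun a ha => by simpa [sub_eq_add_neg] using hC a ha⟩

theorem BddPerLength.expect (hf : BddPerLength f) (κ : List O → PMF O) :
    BddPerLength fun h => expect (κ h) fun o => f (o :: h) := fun n => by
  obtain ⟨C, hC⟩ := hf (n + 1)
  exact ⟨C, fun h hh => abs_expect_le fun o _ => hC _ (by simp [hh])⟩

theorem BddPerLength.bddOn_cons (hf : BddPerLength f) (p : PMF O) (h : List O) :
    BddOn p fun o => f (o :: h) := by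
  obtain ⟨C, hC⟩ := hf (h.length + 1)
  exact bddOn_of_le fun o => hC _ (by simp)

theorem bddPerLength_sum {C : ℝ} (hu : ∀ o, |u o| ≤ C) :
    BddPerLength fun h : List O => (h.map u).sum := fun n => ⟨n * C, fun h hh => by
  induction h generalizing n with
  | nil => simp [← hh]
  | cons o h ih =>
    have h1 := ih h.length rfl
    have h2 := hu o
    subst hh
    simp only [List.map_cons, List.sum_cons, List.length_cons, Nat.cast_add, Nat.cast_one]
    linarith [abs_add_le (u o) (h.map u).sum]⟩

theorem bddPerLength_prod {C : ℝ} (hu : ∀ o, |u o| ≤ C) :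
    BddPerLength fun h : List O => (h.map u).prod := fun n => ⟨C ^ n, fun h hh => by
  induction h generalizing n with
  | nil => simp [← hh]
  | cons o h ih =>
    have h1 := ih h.length rfl
    subst hh
    simp only [List.map_cons, List.prod_cons, List.length_cons, abs_mul, pow_succ']
    exact mul_le_mul (hu o) h1 (abs_nonneg _) ((abs_nonneg _).trans (hu o))⟩

theorem expect_histLaw_succ (hf : BddPerLength f) (κ : List O → PMF O) (n : ℕ) :
    expect (histLaw κ (n + 1)) f
      = expect (histLaw κ n) fun h => expect (κ h) fun o => f (o :: h) := by
  have hb := hf.bddOn κ (n + 1)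
  obtain ⟨C, hC⟩ := hb
  rw [histLaw] at hC ⊢
  rw [expect_bind ⟨C, hC⟩]
  refine expect_congr_on fun h hh => expect_map ⟨C, fun x hx => hC x ?_⟩
  rw [PMF.mem_support_bind_iff]
  exact ⟨h, hh, hx⟩

/-- The expectation of a sum over the rounds, split into the conditional expectations given the
history before each round. -/
theorem expect_sum_histLaw {C : ℝ} (hu : ∀ o, |u o| ≤ C) (κ : List O → PMF O) (n : ℕ) :
    expect (histLaw κ n) (fun h => (h.map u).sum)
      = ∑ t ∈ Finset.range n, expect (histLaw κ t) fun h => expect (κ h) u := by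
  induction n with
  | zero => simp [histLaw, expect_pure]
  | succ n ih =>
    have hb := bddPerLength_sum hu
    have hc : BddPerLength fun h => RandomWalkBandit.expect (κ h) u :=
      bddPerLength_of_le fun h => abs_expect_le fun o _ => hu o
    rw [expect_histLaw_succ hb, Finset.sum_range_succ, ← ih,
      ← expect_add (hb.bddOn κ n) (hc.bddOn κ n)]
    congr 1
    funext h
    simp only [List.map_cons, List.sum_cons]
    rw [expect_add (bddOn_of_le hu) (bddOn_of_le fun _ => le_rfl), expect_const, add_comm]

theorem map_histLaw {O' : Type*} {κ' : List O' → PMF O'} (φ : O → O')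
    (h : ∀ x, (κ x).map φ = κ' (x.map φ)) (n : ℕ) :
    (histLaw κ n).map (List.map φ) = histLaw κ' n := by
  induction n with
  | zero => simp [histLaw, PMF.pure_map]
  | succ n ih =>
    rw [histLaw, histLaw, ← ih, PMF.map_bind, PMF.bind_map]
    congr 1
    funext x
    simp only [Function.comp, ← h, PMF.map_comp]
    rfl

/-- The change of measure: if one round under `κ₁` has density `r` with respect to one round under
`κ₀`, then the history has the product of the densities as its density. -/
theorem expect_histLaw_eq_prod {C : ℝ} (hr : ∀ o, |r o| ≤ C)
    (hκ : ∀ h (g : O → ℝ) (D : ℝ), (∀ o, |g o| ≤ D) →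
      expect (κ₁ h) g = expect (κ₀ h) fun o => r o * g o)
    (hf : BddPerLength f) (n : ℕ) :
    expect (histLaw κ₁ n) f = expect (histLaw κ₀ n) fun h => (h.map r).prod * f h := by
  induction n generalizing f with
  | zero => simp [histLaw, expect_pure]
  | succ n ih =>
    rw [expect_histLaw_succ hf, ih (hf.expect κ₁),
      expect_histLaw_succ ((bddPerLength_prod hr).mul hf)]
    congr 1
    funext h
    obtain ⟨D, hD⟩ := hf (h.length + 1)
    rw [hκ h (fun o => f (o :: h)) D fun o => hD _ (by simp), ← expect_const_mul]
    congr 1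
    funext o
    simp only [List.map_cons, List.prod_cons]
    ring

/-- The `L¹` distance between the density of a history and `1` grows in each round by at most the
expected `L¹` distance between the density of this round and `1`. -/
theorem expect_abs_prod_sub_one_le {C : ℝ} (hr : ∀ o, |r o| ≤ C) (hr0 : ∀ o, 0 ≤ r o)
    (hr1 : ∀ h, expect (κ₀ h) r = 1) (n : ℕ) :
    expect (histLaw κ₀ n) (fun h => |(h.map r).prod - 1|)
      ≤ ∑ t ∈ Finset.range n, expect (histLaw κ₀ t) fun h => expect (κ₀ h) fun o => |r o - 1| := by
  have hd (o : O) : |(|r o - 1|)| ≤ C + 1 := by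
    rw [abs_abs]
    exact (abs_sub _ _).trans (by simpa using hr o)
  induction n with
  | zero => simp [histLaw, expect_pure]
  | succ n ih =>
    have hb := bddPerLength_prod hr
    have hc : BddPerLength fun h => RandomWalkBandit.expect (κ₀ h) fun o => |r o - 1| :=
      bddPerLength_of_le fun h => abs_expect_le fun o _ => hd o
    rw [expect_histLaw_succ hb.abs_sub_one, Finset.sum_range_succ]
    refine le_trans ?_ (add_le_add_left ih _)
    rw [← expect_add (hb.abs_sub_one.bddOn κ₀ n) (hc.bddOn κ₀ n)]
    refine expect_mono ((hb.abs_sub_one.expect κ₀).bddOn κ₀ n)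
      ((hb.abs_sub_one.add hc).bddOn κ₀ n) fun h => ?_
    have e : |(h.map r).prod - 1| + expect (κ₀ h) (fun o => |r o - 1|)
        = expect (κ₀ h) fun o => |(h.map r).prod - 1| * r o + |r o - 1| := by
      rw [expect_add ((bddOn_of_le hr).const_mul _) (bddOn_of_le hd), expect_const_mul, hr1,
        mul_one]
    rw [e]
    refine expect_mono (hb.abs_sub_one.bddOn_cons _ h)
      (((bddOn_of_le hr).const_mul _).add (bddOn_of_le hd)) fun o => ?_
    have e' : ((o :: h).map r).prod - 1 = ((h.map r).prod - 1) * r o + (r o - 1) := by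
      simp only [List.map_cons, List.prod_cons]
      ring
    rw [e']
    exact (abs_add_le _ _).trans (by rw [abs_mul, abs_of_nonneg (hr0 o)])

end history

/-! ### Bounds on the effect of a change of measure -/

/-- The pointwise inequality behind Pinsker's inequality. -/
theorem three_mul_sub_one_sq_le {x : ℝ} (hx : 0 < x) :
    3 * (x - 1) ^ 2 ≤ (4 * x + 2) * (x - 1 - Real.log x) := by
  -- In the form `log x ≤ (x - 1) (x + 5) / (4 x + 2)`; the difference of the two sides has
  -- derivative `(x - 1)³ / (x (2 x + 1)²)`.
  let d : ℝ → ℝ := fun y => (y - 1) * (y + 5) / (4 * y + 2) - Real.log y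
  have hd : ∀ y, 0 < y → HasDerivAt d ((y - 1) ^ 3 / (y * (2 * y + 1) ^ 2)) y := by
    intro y hy
    have h4 : 4 * y + 2 ≠ 0 := by positivity
    have h := (((((hasDerivAt_id y).sub_const 1).mul ((hasDerivAt_id y).add_const 5)).div
      (((hasDerivAt_id y).const_mul 4).add_const 2) h4).sub (Real.hasDerivAt_log hy.ne'))
    refine HasDerivAt.congr_deriv (f := d) h ?_
    have h2 : 2 * y + 1 ≠ 0 := by positivity
    have h5 : (4 * y + 2) = 2 * (2 * y + 1) := by ring
    simp only [Pi.mul_apply, id, h5]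
    field_simp
    ring
  have hcont : ContinuousOn d (Set.Ioi 0) := fun y hy => (hd y hy).continuousAt.continuousWithinAt
  have h1 : d 1 = 0 := by simp [d]
  have key : 0 ≤ d x := by
    rw [← h1]
    rcases le_total 1 x with h | h
    · refine monotoneOn_of_deriv_nonneg (convex_Ici 1)
        (hcont.mono fun y hy => Set.mem_Ioi.2 (one_pos.trans_le (Set.mem_Ici.1 hy)))
        (fun y hy => ?_) (fun y hy => ?_) (Set.mem_Ici.2 le_rfl) h h
      all_goals rw [interior_Ici, Set.mem_Ioi] at hy
      · exact (hd y (by linarith)).differentiableAt.differentiableWithinAt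
      · rw [(hd y (by linarith)).deriv]
        have : 0 ≤ y - 1 := by linarith
        have : 0 < y := by linarith
        positivity
    · refine antitoneOn_of_deriv_nonpos (convex_Ioc 0 1)
        (hcont.mono fun y hy => hy.1)
        (fun y hy => ?_) (fun y hy => ?_) ⟨hx, h⟩ ⟨one_pos, le_rfl⟩ h
      all_goals rw [interior_Ioc] at hy
      · exact (hd y hy.1).differentiableAt.differentiableWithinAt
      · rw [(hd y hy.1).deriv]
        have h3 : (y - 1) ^ 3 ≤ 0 := by
          have : 0 ≤ (1 - y) ^ 3 := pow_nonneg (by linarith [hy.2]) 3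
          nlinarith
        have : 0 < y := hy.1
        exact div_nonpos_of_nonpos_of_nonneg h3 (by positivity)
  have h4 : 0 < 4 * x + 2 := by positivity
  have h5 : Real.log x * (4 * x + 2) ≤ (x - 1) * (x + 5) := by
    rw [← le_div_iff₀ h4]
    linarith
  nlinarith

section density

variable {α : Type*} {p : PMF α} {M f : α → ℝ}

/-- A function with values in `[0, 1]` gains at most half the `L¹` distance of the density from
`1`. -/
theorem expect_density_sub_le (hM : BddOn p M) (hf : ∀ a, 0 ≤ f a ∧ f a ≤ 1)
    (h1 : expect p M = 1) :
    expect p (fun a => M a * f a) - expect p f ≤ expect p (fun a => |M a - 1|) / 2 := by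
  obtain ⟨C, hC⟩ := hM
  have hM : BddOn p M := ⟨C, hC⟩
  have hfb : BddOn p f := bddOn_of_le fun a => abs_le.2 ⟨by linarith [(hf a).1], (hf a).2⟩
  have hMf : BddOn p fun a => M a * f a := ⟨C, fun a ha => by
    rw [abs_mul, abs_of_nonneg (hf a).1]
    exact (mul_le_of_le_one_right (abs_nonneg _) (hf a).2).trans (hC a ha)⟩
  have hc : BddOn p fun _ => (-1 : ℝ) := bddOn_of_le fun _ => le_rfl
  have hM1 : BddOn p fun a => M a - 1 := hM.add hc
  have hA : BddOn p fun a => |M a - 1| := by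
    obtain ⟨D, hD⟩ := hM1
    exact ⟨D, fun a ha => by simpa using hD a ha⟩
  have h0 : expect p (fun a => M a - 1) = 0 := by
    rw [expect_sub hM (bddOn_of_le fun _ => le_rfl), h1, expect_const, sub_self]
  have h2 : expect p (fun a => (1 / 2) * |M a - 1| + (1 / 2) * (M a - 1))
      = expect p (fun a => |M a - 1|) / 2 := by
    rw [expect_add (hA.const_mul _) (hM1.const_mul _), expect_const_mul, expect_const_mul, h0]
    ring
  rw [← h2, ← expect_sub hMf hfb]
  refine expect_mono
    (by simpa only [sub_eq_add_neg, neg_mul, one_mul] using hMf.add (hfb.const_mul (-1)))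
    ((hA.const_mul _).add (hM1.const_mul _)) fun a => ?_
  obtain ⟨h3, h4⟩ := hf a
  rcases abs_cases (M a - 1) with ⟨h, h'⟩ | ⟨h, h'⟩ <;> rw [h] <;> nlinarith

/-- Pinsker's inequality, with the square root replaced by its tangents. -/
theorem expect_abs_density_sub_one_le (hM : BddOn p M) (hpos : ∀ a, 0 < M a)
    (hlog : BddOn p fun a => Real.log (M a)) (h1 : expect p M = 1) {c : ℝ} (hc : 0 < c) :
    expect p (fun a => |M a - 1|) ≤ c - expect p (fun a => Real.log (M a)) / (2 * c) := by
  have hk (d : ℝ) : BddOn p fun _ => d := bddOn_of_le fun _ => le_rfl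
  have hA : BddOn p fun a => |M a - 1| := by
    obtain ⟨D, hD⟩ := hM.add (hk (-1))
    exact ⟨D, fun a ha => by simpa [sub_eq_add_neg] using hD a ha⟩
  have hB := ((hM.const_mul (2 * c / 3 + 1 / (2 * c))).add (hk (c / 3 - 1 / (2 * c)))).add
    (hlog.const_mul (-(1 / (2 * c))))
  have e : c - expect p (fun a => Real.log (M a)) / (2 * c)
      = expect p fun a => ((2 * c / 3 + 1 / (2 * c)) * M a + (c / 3 - 1 / (2 * c)))
        + -(1 / (2 * c)) * Real.log (M a) := by
    rw [expect_add ((hM.const_mul _).add (hk _)) (hlog.const_mul _),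
      expect_add (hM.const_mul _) (hk _), expect_const_mul, expect_const_mul, expect_const, h1]
    ring
  rw [e]
  refine expect_mono hA hB fun a => ?_
  have key := three_mul_sub_one_sq_le (hpos a)
  set m := M a
  set y := m - 1 - Real.log m
  have h2 : 0 < (4 * m + 2) := by linarith [hpos a]
  have e2 : ((2 * c / 3 + 1 / (2 * c)) * m + (c / 3 - 1 / (2 * c))) + -(1 / (2 * c)) * Real.log m
      = c * ((4 * m + 2) / 3) / 2 + y / c / 2 := by
    simp only [y]
    field_simp
    ring
  rw [e2]
  -- The arithmetic-geometric mean inequality for the two factors of the pointwise bound.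
  refine abs_le_of_sq_le_sq ?_ ?_
  · have h3 : (m - 1) ^ 2 ≤ (c * ((4 * m + 2) / 3)) * (y / c) := by
      have : (c * ((4 * m + 2) / 3)) * (y / c) = (4 * m + 2) * y / 3 := by field_simp
      rw [this]
      linarith
    nlinarith [sq_nonneg (c * ((4 * m + 2) / 3) - y / c)]
  · have hy : 0 ≤ y := by
      have := Real.log_le_sub_one_of_pos (hpos a)
      simp only [y]
      linarith
    positivity

end density

/-! ### The random walk, step by step -/

theorem tsum_list {α : Type*} [Fintype α] {F : List α → ℝ} (hF : Summable F) :
    ∑' l, F l = F [] + ∑ x, ∑' l, F (x :: l) := by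
  let e : Unit ⊕ (α × List α) ≃ List α :=
    { toFun := Sum.elim (fun _ => []) fun x => x.1 :: x.2
      invFun := fun l => match l with
        | [] => .inl ()
        | x :: l => .inr (x, l)
      left_inv := fun x => match x with
        | .inl () => rfl
        | .inr (_, _) => rfl
      right_inv := fun l => match l with
        | [] => rfl
        | _ :: _ => rfl }
  have h2 : Summable fun x : α × List α => F (x.1 :: x.2) :=
    hF.comp_injective (i := fun x : α × List α => x.1 :: x.2) fun x y h => by
      obtain ⟨h1, h2⟩ := List.cons.inj h
      exact Prod.ext h1 h2
  rw [← e.tsum_eq, Summable.tsum_sum (f := fun x => F (e x)) (Summable.of_finite) h2, tsum_fintype]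
  have e1 (x : α × List α) : F (e (.inr x)) = F (x.1 :: x.2) := rfl
  simp only [e1]
  rw [h2.tsum_prod, tsum_fintype]
  simp [e]

variable {K : ℕ}

theorem toReal_walk_nil (i : Fin K) : (walk i []).toReal = 1 / 2 := by
  have h : walk i [] = 1 - ∑ j, transition K i j := rfl
  rw [h, sum_transition, ENNReal.one_sub_inv_two]
  simp

theorem toReal_walk_cons (i x : Fin K) (path : List (Fin K)) :
    (walk i (x :: path)).toReal = stepProb K * (walk x path).toReal := by
  have h : walk i (x :: path) = transition K i x * walk x path := rfl
  have h0 : 0 ≤ stepProb K := by unfold stepProb; positivity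
  rw [h, ENNReal.toReal_mul, transition, ENNReal.toReal_ofReal h0]

/-- The Markov property of the walk at its first step. -/
theorem expect_walk {i : Fin K} {f : List (Fin K) → ℝ}
    (hf : Summable fun path => (walk i path).toReal * f path) :
    expect (walk i) f
      = 1 / 2 * f [] + ∑ x, stepProb K * expect (walk x) fun path => f (x :: path) := by
  rw [expect, tsum_list hf, toReal_walk_nil]
  simp only [expect, toReal_walk_cons, ← tsum_mul_left, mul_assoc]

theorem stepProb_mul_self (i : Fin K) : (K : ℝ) * stepProb K = 1 / 2 := by
  have : (0 : ℝ) < K := by exact_mod_cast i.pos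
  unfold stepProb
  field_simp

/-- The law of the node from which the walk is absorbed, `path.getLastD i` for a walk started
at `i`. -/
theorem expect_walk_last (i k : Fin K) :
    expect (walk i) (fun path => if path.getLastD i = k then 1 else 0)
      = stepProb K + if i = k then 1 / 2 else 0 := by
  have hb (i : Fin K) : BddOn (walk i) fun path => if path.getLastD i = k then (1 : ℝ) else 0 :=
    bddOn_of_le (C := 1) fun path => by split_ifs <;> simp
  let a : Fin K → ℝ := fun i =>
    expect (walk i) fun path => if path.getLastD i = k then (1 : ℝ) else 0
  have ha (i : Fin K) : a i = stepProb K * ∑ x, a x + if i = k then 1 / 2 else 0 := by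
    have h := expect_walk (hb i).summable
    simp only [List.getLastD_cons, List.getLastD_nil] at h
    simp only [a, h, Finset.mul_sum]
    by_cases hik : i = k <;> simp [hik, add_comm]
  -- Summed over the starting node, the recursion determines the total of the probabilities.
  have hs : ∑ x, a x = 1 := by
    have h : ∑ x, a x = ∑ x, (stepProb K * ∑ y, a y + if x = k then 1 / 2 else 0) :=
      Finset.sum_congr rfl fun x _ => ha x
    rw [Finset.sum_add_distrib, Finset.sum_const, Finset.card_univ, Fintype.card_fin,
      nsmul_eq_mul, ← mul_assoc, stepProb_mul_self k, Finset.sum_ite_eq' Finset.univ k] at h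
    simp only [Finset.mem_univ, if_true] at h
    linarith
  have := ha i
  rwa [hs, mul_one] at this

/-- The expected hitting time satisfies the first-step equation. -/
theorem meanHittingTime_eq (l : EdgeLengths K) (i : Fin K) :
    meanHittingTime l i = 1 / 2 * (l (i, none)).toNat
      + ∑ x, stepProb K * ((l (i, some x)).toNat + meanHittingTime l x) := by
  have h := expect_walk (summable_meanHittingTime l i)
  have e : meanHittingTime l i
    = expect (walk i) fun path => (hittingTime (trajectory l i path) : ℝ) := rfl
  rw [e, h]
  refine congrArg₂ (· + ·) (by simp [trajectory, hittingTime]) ?_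
  refine Finset.sum_congr rfl fun x _ => ?_
  congr 1
  have hc : (fun path => (hittingTime (trajectory l i (x :: path)) : ℝ))
      = fun path => ((l (i, some x)).toNat : ℝ) + hittingTime (trajectory l x path) := by
    funext path
    simp [trajectory, hittingTime]
  have hs1 : Summable fun path => (walk x path).toReal * ((l (i, some x)).toNat : ℝ) :=
    (summable_toReal _).mul_right _
  rw [hc, expect]
  simp only [mul_add]
  rw [hs1.tsum_add (summable_meanHittingTime l x), tsum_mul_right, tsum_toReal, one_mul]
  rfl

/-! ### The edge lengths -/

theorem toReal_bernoulli (q : unitInterval) (b : Bool) :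
    (bernoulli q b).toReal = if b then (q : ℝ) else 1 - q := by
  have h : bernoulli q b = ENNReal.ofReal (if b then (q : ℝ) else 1 - q) := rfl
  rw [h, ENNReal.toReal_ofReal]
  split_ifs
  · exact q.2.1
  · exact sub_nonneg.2 q.2.2

theorem toReal_edgeLaw (q : Fin K × Option (Fin K) → unitInterval) (l : EdgeLengths K) :
    (edgeLaw q l).toReal = ∏ e, if l e then (q e : ℝ) else 1 - q e := by
  have h : edgeLaw q l = ∏ e, bernoulli (q e) (l e) := rfl
  rw [h, ENNReal.toReal_prod]
  exact Finset.prod_congr rfl fun e _ => toReal_bernoulli _ _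

theorem expect_edgeLaw_apply (q : Fin K × Option (Fin K) → unitInterval)
    (e : Fin K × Option (Fin K)) (u : Bool → ℝ) :
    expect (edgeLaw q) (fun l => u (l e)) = q e * u true + (1 - q e) * u false := by
  have h := Finset.prod_univ_sum
    (fun _ : Fin K × Option (Fin K) => (Finset.univ : Finset Bool))
    (fun e' b => (if b then (q e' : ℝ) else 1 - q e') * if e' = e then u b else 1)
  rw [Fintype.piFinset_univ] at h
  have hl : expect (edgeLaw q) (fun l => u (l e))
      = ∑ l : EdgeLengths K, ∏ e', ((if l e' then (q e' : ℝ) else 1 - q e')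
        * if e' = e then u (l e') else 1) := by
    rw [expect_fintype]
    refine Finset.sum_congr rfl fun l _ => ?_
    rw [Finset.prod_mul_distrib, toReal_edgeLaw]
    simp
  rw [hl, ← h, Finset.prod_eq_single e]
  · simp
  · intro e' _ he'
    simp [he']
  · simp

/-- The sign `1` of the length `1` and `-1` of the length `0`. -/
def lengthSign (b : Bool) : ℝ := if b then 1 else -1

variable {q₀ q : Fin K × Option (Fin K) → unitInterval} {k : Fin K} {s : ℝ}

theorem toReal_edgeLaw_perturbed (h₀ : ∀ e, (q₀ e : ℝ) = 1 / 2)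
    (hq : ∀ e, (q e : ℝ) = 1 / 2 + if e = (k, none) then s / 2 else 0) (l : EdgeLengths K) :
    (edgeLaw q l).toReal = (edgeLaw q₀ l).toReal * (1 + s * lengthSign (l (k, none))) := by
  have h : ∀ e, (if l e then (q e : ℝ) else 1 - q e) = (if l e then (q₀ e : ℝ) else 1 - q₀ e)
      * if e = (k, none) then 1 + s * lengthSign (l e) else 1 := by
    intro e
    rw [h₀, hq, lengthSign]
    split_ifs <;> ring
  rw [toReal_edgeLaw, toReal_edgeLaw, Finset.prod_congr rfl fun e _ => h e,
    Finset.prod_mul_distrib]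
  simp

theorem toReal_edgeLaw_uniform (h₀ : ∀ e, (q₀ e : ℝ) = 1 / 2) (l l' : EdgeLengths K) :
    (edgeLaw q₀ l).toReal = (edgeLaw q₀ l').toReal := by
  rw [toReal_edgeLaw, toReal_edgeLaw]
  refine Finset.prod_congr rfl fun e _ => ?_
  rw [h₀]
  split_ifs <;> norm_num

/-- The expected advantage in hitting time of starting elsewhere than at the perturbed node: only
the first step matters, as all rows of the transition matrix agree. -/
theorem expect_meanHittingTime_sub
    (hq : ∀ e, (q e : ℝ) = 1 / 2 + if e = (k, none) then s / 2 else 0) (j : Fin K) :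
    expect (edgeLaw q) (fun l => meanHittingTime l k - meanHittingTime l j)
      = if j = k then 0 else s / 4 := by
  have hb (f : EdgeLengths K → ℝ) : BddOn (edgeLaw q) f := bddOn_fintype _ _
  have hm (e : Fin K × Option (Fin K)) :
      expect (edgeLaw q) (fun l => ((l e).toNat : ℝ)) = q e := by
    rw [expect_edgeLaw_apply q e fun b => (b.toNat : ℝ)]
    simp
  have hsum (F : Fin K → EdgeLengths K → ℝ) : expect (edgeLaw q) (fun l => ∑ x, F x l)
      = ∑ x, expect (edgeLaw q) (F x) := by
    simp only [expect_fintype, Finset.mul_sum]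
    exact Finset.sum_comm
  have h (i : Fin K) : expect (edgeLaw q) (fun l => meanHittingTime l i)
      = 1 / 2 * q (i, none)
        + ∑ x, stepProb K * (1 / 2 + expect (edgeLaw q) fun l => meanHittingTime l x) := by
    rw [funext fun l => meanHittingTime_eq l i, expect_add (hb _) (hb _), expect_const_mul, hm,
      hsum]
    congr 1
    refine Finset.sum_congr rfl fun x _ => ?_
    rw [expect_const_mul, expect_add (hb _) (hb _), hm, hq]
    simp
  rw [expect_sub (hb _) (hb _), h k, h j, hq, hq]
  simp only [Prod.mk.injEq, and_true, if_true]
  split_ifs <;> ring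

/-! ### The observed trajectory -/

/-- The likelihood ratio of the trajectory `τ` started at `i`, for the walk with the edge from `k`
to the absorbing node perturbed against the unperturbed walk: the length of the last edge counts
if this edge starts at `k`, and nothing else does. -/
noncomputable def likelihoodRatio (k : Fin K) (s : ℝ) : Fin K → Trajectory K → ℝ
  | _, [] => 1
  | i, (b, none) :: _ => if i = k then 1 + s * lengthSign b else 1
  | _, (_, some x) :: τ => likelihoodRatio k s x τ

theorem likelihoodRatio_trajectory (k : Fin K) (s : ℝ) (l : EdgeLengths K) (i : Fin K)
    (path : List (Fin K)) :
    likelihoodRatio k s i (trajectory l i path)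
      = if path.getLastD i = k then 1 + s * lengthSign (l (k, none)) else 1 := by
  induction path generalizing i with
  | nil =>
    simp only [trajectory, likelihoodRatio, List.getLastD_nil]
    by_cases h : i = k <;> simp [h]
  | cons x path ih => rw [trajectory, likelihoodRatio, ih, List.getLastD_cons]

theorem abs_mul_lengthSign (hs : 0 ≤ s) (b : Bool) : |s * lengthSign b| = s := by
  cases b <;> simp [lengthSign, abs_of_nonneg hs]

theorem likelihoodRatio_mem (hs : 0 ≤ s) (i : Fin K) (τ : Trajectory K) :
    1 - s ≤ likelihoodRatio k s i τ ∧ likelihoodRatio k s i τ ≤ 1 + s := by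
  induction τ generalizing i with
  | nil => constructor <;> simp [likelihoodRatio, hs]
  | cons x τ ih =>
    obtain ⟨b, _ | x⟩ := x
    · simp only [likelihoodRatio]
      have := abs_le.1 (abs_mul_lengthSign hs b).le
      split_ifs <;> constructor <;> linarith
    · exact ih x

theorem trajectory_update (l : EdgeLengths K) (b : Bool) {i : Fin K} {path : List (Fin K)}
    (h : path.getLastD i ≠ k) :
    trajectory (Function.update l (k, none) b) i path = trajectory l i path := by
  induction path generalizing i with
  | nil => simp [trajectory, show i ≠ k from h]
  | cons x path ih =>
    rw [List.getLastD_cons] at h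
    simp [trajectory, ih h]

/-- `likelihoodRatio` is the density of the trajectory in the perturbed graph with respect to the
trajectory in the unperturbed graph. -/
theorem expect_trajectory_perturbed (h₀ : ∀ e, (q₀ e : ℝ) = 1 / 2)
    (hq : ∀ e, (q e : ℝ) = 1 / 2 + if e = (k, none) then s / 2 else 0) (i : Fin K)
    (path : List (Fin K)) (g : Trajectory K → ℝ) :
    expect (edgeLaw q) (fun l => g (trajectory l i path))
      = expect (edgeLaw q₀) fun l =>
        likelihoodRatio k s i (trajectory l i path) * g (trajectory l i path) := by
  simp only [likelihoodRatio_trajectory, expect_fintype, toReal_edgeLaw_perturbed h₀ hq]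
  split_ifs with h
  · exact Finset.sum_congr rfl fun l _ => by ring
  -- The trajectory does not see the perturbed edge, so flipping the length of this edge shows
  -- that the perturbation cancels.
  let flip : EdgeLengths K → EdgeLengths K := fun l =>
    Function.update l (k, none) (!l (k, none))
  have hflip : Function.Involutive flip := fun l => by simp [flip]
  let F : EdgeLengths K → ℝ := fun l =>
    (edgeLaw q₀ l).toReal * lengthSign (l (k, none)) * g (trajectory l i path)
  have hF (l : EdgeLengths K) : F (flip l) = -F l := by
    simp only [F, toReal_edgeLaw_uniform h₀ (flip l) l]
    simp only [flip, trajectory_update l _ h, Function.update_self]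
    cases l (k, none) <;> simp [lengthSign]
  have h0 : ∑ l, F l = 0 := by
    have h1 : ∑ l, F (flip l) = ∑ l, F l := Equiv.sum_comp hflip.toPerm F
    simp only [hF, Finset.sum_neg_distrib] at h1
    linarith
  have e : ∀ l : EdgeLengths K, (edgeLaw q₀ l).toReal * (1 + s * lengthSign (l (k, none)))
      * g (trajectory l i path)
      = (edgeLaw q₀ l).toReal * (1 * g (trajectory l i path)) + s * F l := fun l => by
    simp only [F]
    ring
  rw [Finset.sum_congr rfl fun l _ => e l, Finset.sum_add_distrib, ← Finset.mul_sum, h0]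
  ring

theorem expect_likelihoodRatio (h₀ : ∀ e, (q₀ e : ℝ) = 1 / 2) {φ : ℝ → ℝ}
    (hφ : φ 1 = 0) (i : Fin K) :
    expect (edgeLaw q₀) (fun l => expect (walk i) fun path =>
        φ (likelihoodRatio k s i (trajectory l i path)))
      = (stepProb K + if i = k then 1 / 2 else 0) * ((φ (1 + s) + φ (1 - s)) / 2) := by
  have e (l : EdgeLengths K) : (expect (walk i) fun path =>
      φ (likelihoodRatio k s i (trajectory l i path)))
      = (stepProb K + if i = k then 1 / 2 else 0) * φ (1 + s * lengthSign (l (k, none))) := by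
    rw [← expect_walk_last, ← expect_mul_const]
    congr 1
    funext path
    rw [likelihoodRatio_trajectory]
    split_ifs <;> simp [hφ]
  simp only [e, expect_const_mul]
  rw [expect_edgeLaw_apply q₀ (k, none) fun b => φ (1 + s * lengthSign b), h₀]
  simp only [lengthSign, if_true, Bool.false_eq_true, if_false]
  rw [mul_one, mul_neg_one, ← sub_eq_add_neg]
  ring

/-! ### One epoch -/

/-- The law of one epoch when the node to play has law `ν`. -/
noncomputable def epochLaw (q : Fin K × Option (Fin K) → unitInterval) (ν : PMF (Fin K)) :
    PMF (Epoch K) :=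
  ν.bind fun j => (edgeLaw q).bind fun l => (walk j).map fun path => ⟨j, l, trajectory l j path⟩

theorem expect_epochLaw {f : Epoch K → ℝ} {C : ℝ} (hf : ∀ e, |f e| ≤ C)
    (q : Fin K × Option (Fin K) → unitInterval) (ν : PMF (Fin K)) :
    expect (epochLaw q ν) f = expect ν fun j => expect (edgeLaw q) fun l =>
      expect (walk j) fun path => f ⟨j, l, trajectory l j path⟩ := by
  have hb {p : PMF (Epoch K)} : BddOn p f := bddOn_of_le hf
  simp only [epochLaw, expect_bind hb, expect_map hb]

theorem law_eq_histLaw (q : Fin K × Option (Fin K) → unitInterval) (π : Policy K) (n : ℕ) :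
    law q π n = histLaw (fun h => epochLaw q (π (h.map Epoch.observed))) n := by
  induction n with
  | zero => rfl
  | succ n ih =>
    rw [law, histLaw, ih]
    simp only [epochLaw, PMF.map_bind, PMF.map_comp]
    rfl

/-- The law of the next observation of the player, given the past observations. -/
noncomputable def obsKernel (q : Fin K × Option (Fin K) → unitInterval) (π : Policy K)
    (o : List (Fin K × Trajectory K)) : PMF (Fin K × Trajectory K) :=
  (epochLaw q (π o)).map Epoch.observed

theorem map_law (q : Fin K × Option (Fin K) → unitInterval) (π : Policy K) (n : ℕ) :
    (law q π n).map (List.map Epoch.observed) = histLaw (obsKernel q π) n := by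
  rw [law_eq_histLaw]
  exact map_histLaw _ (fun _ => rfl) n

theorem expect_obsKernel {g : Fin K × Trajectory K → ℝ} {C : ℝ} (hg : ∀ o, |g o| ≤ C)
    (q : Fin K × Option (Fin K) → unitInterval) (π : Policy K)
    (o : List (Fin K × Trajectory K)) :
    expect (obsKernel q π o) g = expect (π o) fun j => expect (edgeLaw q) fun l =>
      expect (walk j) fun path => g (j, trajectory l j path) := by
  rw [obsKernel, expect_map (bddOn_of_le hg), expect_epochLaw (fun e => hg _)]
  rfl

theorem expect_obsKernel_perturbed (h₀ : ∀ e, (q₀ e : ℝ) = 1 / 2) (hs : 0 ≤ s)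
    (hq : ∀ e, (q e : ℝ) = 1 / 2 + if e = (k, none) then s / 2 else 0) (π : Policy K)
    (o : List (Fin K × Trajectory K)) {g : Fin K × Trajectory K → ℝ} {C : ℝ}
    (hg : ∀ o, |g o| ≤ C) :
    expect (obsKernel q π o) g
      = expect (obsKernel q₀ π o) fun x => likelihoodRatio k s x.1 x.2 * g x := by
  have hr (x : Fin K × Trajectory K) : |likelihoodRatio k s x.1 x.2 * g x| ≤ (1 + s) * C := by
    have h := likelihoodRatio_mem (k := k) hs x.1 x.2
    rw [abs_mul]
    exact mul_le_mul (abs_le.2 ⟨by linarith, h.2⟩) (hg x) (abs_nonneg _) (by linarith)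
  rw [expect_obsKernel hg, expect_obsKernel hr]
  congr 1
  funext j
  rw [expect_comm _ _ fun _ _ => hg _, expect_comm _ _ fun _ _ => hr (_, _)]
  congr 1
  funext path
  exact expect_trajectory_perturbed h₀ hq j path fun τ => g (j, τ)

theorem expect_indicator (ν : PMF (Fin K)) (k : Fin K) (a b : ℝ) :
    expect ν (fun j => if j = k then a else b) = (ν k).toReal * a + (1 - (ν k).toReal) * b := by
  have h : (fun j => if j = k then a else b)
      = fun j => (if j = k then 1 else 0) * (a - b) + b := by
    funext j
    split_ifs <;> ring
  rw [h, expect_add (bddOn_fintype _ _) (bddOn_fintype _ _), expect_mul_const, expect_const,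
    expect_fintype]
  simp only [mul_ite, mul_one, mul_zero, Finset.sum_ite_eq', Finset.mem_univ, if_true]
  ring

/-- Functions of the likelihood ratio of one observation that vanish at `1` only feel the
probability that the walk is absorbed from the node `k`. -/
theorem expect_obsKernel_likelihoodRatio (h₀ : ∀ e, (q₀ e : ℝ) = 1 / 2) (hs : 0 ≤ s)
    {φ : ℝ → ℝ} (hφ : φ 1 = 0) {C : ℝ} (hC : ∀ y, 1 - s ≤ y → y ≤ 1 + s → |φ y| ≤ C)
    (π : Policy K) (o : List (Fin K × Trajectory K)) :
    expect (obsKernel q₀ π o) (fun x => φ (likelihoodRatio k s x.1 x.2))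
      = (stepProb K + (π o k).toReal / 2) * ((φ (1 + s) + φ (1 - s)) / 2) := by
  have hr (x : Fin K × Trajectory K) : |φ (likelihoodRatio k s x.1 x.2)| ≤ C :=
    hC _ (likelihoodRatio_mem hs _ _).1 (likelihoodRatio_mem hs _ _).2
  rw [expect_obsKernel hr]
  simp only [expect_likelihoodRatio h₀ hφ]
  rw [expect_mul_const, expect_add (bddOn_fintype _ _) (bddOn_fintype _ _), expect_const,
    expect_indicator]
  ring

/-! ### The regret and the number of plays -/

/-- The expected number of epochs, among the first `T`, in which the node `k` is played. -/
noncomputable def expectedPlays (q : Fin K × Option (Fin K) → unitInterval) (π : Policy K) (T : ℕ)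
    (k : Fin K) : ℝ :=
  ∑ t ∈ Finset.range T, expect (histLaw (obsKernel q π) t) fun o => (π o k).toReal

theorem toReal_mem {α : Type*} (p : PMF α) (a : α) : 0 ≤ (p a).toReal ∧ (p a).toReal ≤ 1 :=
  ⟨ENNReal.toReal_nonneg,
    ENNReal.toReal_le_of_le_ofReal zero_le_one (by simpa using p.coe_le_one a)⟩

theorem abs_policy_le (π : Policy K) (k : Fin K) (o : List (Fin K × Trajectory K)) :
    |(π o k).toReal| ≤ 1 :=
  abs_le.2 ⟨by linarith [(toReal_mem (π o) k).1], (toReal_mem (π o) k).2⟩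

theorem exists_abs_meanHittingTime_sub_le (k : Fin K) :
    ∃ C, ∀ e : Epoch K, |meanHittingTime e.lengths k - meanHittingTime e.lengths e.node| ≤ C := by
  obtain ⟨C, hC⟩ := (Set.finite_range fun x : EdgeLengths K × Fin K =>
    |meanHittingTime x.1 k - meanHittingTime x.1 x.2|).bddAbove
  exact ⟨C, fun e => hC ⟨(e.lengths, e.node), rfl⟩⟩

theorem summable_regret (q : Fin K × Option (Fin K) → unitInterval) (π : Policy K) (T : ℕ)
    (k : Fin K) : Summable fun h => (law q π T h).toReal * regret k h := by
  obtain ⟨C, hC⟩ := exists_abs_meanHittingTime_sub_le k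
  rw [law_eq_histLaw]
  exact ((bddPerLength_sum hC).bddOn _ T).summable

theorem expectedRegret_eq {q : Fin K × Option (Fin K) → unitInterval} {k : Fin K} {s : ℝ}
    (hq : ∀ e, (q e : ℝ) = 1 / 2 + if e = (k, none) then s / 2 else 0) (π : Policy K) (T : ℕ) :
    expectedRegret q π T k = s / 4 * (T - expectedPlays q π T k) := by
  obtain ⟨C, hC⟩ := exists_abs_meanHittingTime_sub_le k
  have h : expectedRegret q π T k = expect (law q π T) fun h =>
    (h.map fun e => meanHittingTime e.lengths k - meanHittingTime e.lengths e.node).sum := rfl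
  have hstep (t : ℕ) : expect (law q π t) (fun h =>
      expect (epochLaw q (π (h.map Epoch.observed))) fun e =>
        meanHittingTime e.lengths k - meanHittingTime e.lengths e.node)
      = s / 4 * (1 - expect (histLaw (obsKernel q π) t) fun o => (π o k).toReal) := by
    have hb (p : PMF (List (Fin K × Trajectory K))) : BddOn p fun o => (π o k).toReal :=
      bddOn_of_le (abs_policy_le π k)
    rw [← map_law, expect_map (hb _)]
    have e (h : List (Epoch K)) : (expect (epochLaw q (π (h.map Epoch.observed))) fun e =>
        meanHittingTime e.lengths k - meanHittingTime e.lengths e.node)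
        = s / 4 * (1 - (π (h.map Epoch.observed) k).toReal) := by
      rw [expect_epochLaw hC]
      simp only [expect_const, expect_meanHittingTime_sub hq, expect_indicator]
      ring
    simp only [e]
    rw [expect_const_mul, expect_sub (bddOn_of_le fun _ => le_rfl)
      (bddOn_of_le fun h => abs_policy_le π k _), expect_const]
  rw [h, law_eq_histLaw, expect_sum_histLaw hC]
  simp only [← law_eq_histLaw, hstep]
  rw [← Finset.mul_sum, Finset.sum_sub_distrib]
  simp [expectedPlays]

/-! ### The information about the perturbed node -/

/-- The expected number of walks, in the first `t` epochs, that are absorbed from the node `k`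
in the unperturbed graph: the player learns about the perturbed edge only from these. -/
noncomputable def expectedExits (q₀ : Fin K × Option (Fin K) → unitInterval) (π : Policy K)
    (t : ℕ) (k : Fin K) : ℝ :=
  ∑ u ∈ Finset.range t,
    expect (histLaw (obsKernel q₀ π) u) fun o => stepProb K + (π o k).toReal / 2

theorem sum_expect_policy (q : Fin K × Option (Fin K) → unitInterval) (π : Policy K) (t : ℕ) :
    ∑ k, expect (histLaw (obsKernel q π) t) (fun o => (π o k).toReal) = 1 := by
  have hs (k : Fin K) : Summable fun o =>
      (histLaw (obsKernel q π) t o).toReal * (π o k).toReal :=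
    (bddOn_of_le (abs_policy_le π k)).summable
  simp only [expect]
  rw [← Summable.tsum_finsetSum fun k _ => hs k, ← expect_const (histLaw (obsKernel q π) t) 1]
  refine tsum_congr fun o => ?_
  rw [← Finset.mul_sum, ← tsum_toReal (π o), tsum_fintype]

theorem sum_expectedPlays (q : Fin K × Option (Fin K) → unitInterval) (π : Policy K) (T : ℕ) :
    ∑ k, expectedPlays q π T k = T := by
  simp only [expectedPlays]
  rw [Finset.sum_comm]
  simp [sum_expect_policy]

theorem expectedExits_eq (q₀ : Fin K × Option (Fin K) → unitInterval) (π : Policy K) (t : ℕ)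
    (k : Fin K) : expectedExits q₀ π t k = t * stepProb K + expectedPlays q₀ π t k / 2 := by
  have h (u : ℕ) : expect (histLaw (obsKernel q₀ π) u) (fun o => stepProb K + (π o k).toReal / 2)
      = stepProb K + expect (histLaw (obsKernel q₀ π) u) (fun o => (π o k).toReal) * (1 / 2) := by
    have hb : BddOn (histLaw (obsKernel q₀ π) u) fun o => (π o k).toReal * (1 / 2) :=
      bddOn_of_le (C := 1) fun o => by
        rw [abs_mul, abs_of_pos (one_half_pos (α := ℝ))]
        linarith [abs_policy_le π k o]
    have e : (fun o => stepProb K + (π o k).toReal / 2)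
        = fun o => stepProb K + (π o k).toReal * (1 / 2) := by
      funext o
      ring
    rw [e, expect_add (bddOn_of_le fun _ => le_rfl) hb, expect_const, expect_mul_const]
  simp only [expectedExits, h, Finset.sum_add_distrib, ← Finset.sum_mul, expectedPlays]
  simp
  ring

theorem sum_expectedExits (hK : 1 ≤ K) (q₀ : Fin K × Option (Fin K) → unitInterval)
    (π : Policy K) (t : ℕ) : ∑ k, expectedExits q₀ π t k = t := by
  simp only [expectedExits_eq, Finset.sum_add_distrib, ← Finset.sum_div, sum_expectedPlays]
  have h := stepProb_mul_self (⟨0, hK⟩ : Fin K)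
  rw [Finset.sum_const, Finset.card_univ, Fintype.card_fin, nsmul_eq_mul]
  linear_combination (t : ℝ) * h

section

variable {q₀ q : Fin K × Option (Fin K) → unitInterval} {k : Fin K} {s : ℝ}

/-- The density of the observations of the perturbed walk with respect to the unperturbed one. -/
noncomputable def historyRatio (k : Fin K) (s : ℝ) (o : List (Fin K × Trajectory K)) : ℝ :=
  (o.map fun x => likelihoodRatio k s x.1 x.2).prod

theorem abs_likelihoodRatio_le (hs : 0 ≤ s) (x : Fin K × Trajectory K) :
    |likelihoodRatio k s x.1 x.2| ≤ 1 + s :=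
  abs_le.2 ⟨by linarith [(likelihoodRatio_mem (k := k) hs x.1 x.2).1],
    (likelihoodRatio_mem hs x.1 x.2).2⟩

theorem likelihoodRatio_pos (hs : 0 ≤ s) (hs1 : s < 1) (x : Fin K × Trajectory K) :
    0 < likelihoodRatio k s x.1 x.2 := by
  linarith [(likelihoodRatio_mem (k := k) hs x.1 x.2).1]

theorem historyRatio_pos (hs : 0 ≤ s) (hs1 : s < 1) (o : List (Fin K × Trajectory K)) :
    0 < historyRatio k s o :=
  List.prod_pos fun y hy => by
    obtain ⟨x, -, rfl⟩ := List.mem_map.1 hy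
    exact likelihoodRatio_pos hs hs1 x

theorem log_historyRatio (hs : 0 ≤ s) (hs1 : s < 1) (o : List (Fin K × Trajectory K)) :
    Real.log (historyRatio k s o)
      = (o.map fun x => Real.log (likelihoodRatio k s x.1 x.2)).sum := by
  induction o with
  | nil => simp [historyRatio]
  | cons x o ih =>
    have h : historyRatio k s (x :: o) = likelihoodRatio k s x.1 x.2 * historyRatio k s o := by
      simp [historyRatio]
    rw [h, Real.log_mul (likelihoodRatio_pos hs hs1 x).ne' (historyRatio_pos hs hs1 o).ne', ih]
    simp

theorem expect_perturbed (h₀ : ∀ e, (q₀ e : ℝ) = 1 / 2) (hs : 0 ≤ s)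
    (hq : ∀ e, (q e : ℝ) = 1 / 2 + if e = (k, none) then s / 2 else 0) (π : Policy K)
    {f : List (Fin K × Trajectory K) → ℝ} (hf : BddPerLength f) (t : ℕ) :
    expect (histLaw (obsKernel q π) t) f
      = expect (histLaw (obsKernel q₀ π) t) fun o => historyRatio k s o * f o :=
  expect_histLaw_eq_prod (r := fun x => likelihoodRatio k s x.1 x.2) (abs_likelihoodRatio_le hs)
    (fun o _ _ hg => expect_obsKernel_perturbed h₀ hs hq π o hg) hf t

theorem expect_historyRatio (h₀ : ∀ e, (q₀ e : ℝ) = 1 / 2) (hs : 0 ≤ s)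
    (hq : ∀ e, (q e : ℝ) = 1 / 2 + if e = (k, none) then s / 2 else 0) (π : Policy K) (t : ℕ) :
    expect (histLaw (obsKernel q₀ π) t) (historyRatio k s) = 1 := by
  have h := expect_perturbed h₀ hs hq π (f := fun _ => 1) (bddPerLength_of_le fun _ => le_rfl) t
  simpa using h.symm

theorem expect_policy_sub_le (h₀ : ∀ e, (q₀ e : ℝ) = 1 / 2) (hs : 0 ≤ s)
    (hq : ∀ e, (q e : ℝ) = 1 / 2 + if e = (k, none) then s / 2 else 0) (π : Policy K) (t : ℕ) :
    expect (histLaw (obsKernel q π) t) (fun o => (π o k).toReal)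
        - expect (histLaw (obsKernel q₀ π) t) (fun o => (π o k).toReal)
      ≤ expect (histLaw (obsKernel q₀ π) t) (fun o => |historyRatio k s o - 1|) / 2 := by
  rw [expect_perturbed h₀ hs hq π (bddPerLength_of_le (abs_policy_le π k)) t]
  exact expect_density_sub_le ((bddPerLength_prod (abs_likelihoodRatio_le hs)).bddOn _ t)
    (fun o => toReal_mem _ _) (expect_historyRatio h₀ hs hq π t)

/-- The bound that is good for few epochs: total variation distances add up. -/
theorem expect_policy_sub_le_linear (h₀ : ∀ e, (q₀ e : ℝ) = 1 / 2) (hs : 0 ≤ s) (hs1 : s < 1)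
    (hq : ∀ e, (q e : ℝ) = 1 / 2 + if e = (k, none) then s / 2 else 0) (π : Policy K) (t : ℕ) :
    expect (histLaw (obsKernel q π) t) (fun o => (π o k).toReal)
        - expect (histLaw (obsKernel q₀ π) t) (fun o => (π o k).toReal)
      ≤ s / 2 * expectedExits q₀ π t k := by
  refine (expect_policy_sub_le h₀ hs hq π t).trans ?_
  have h1 (o : List (Fin K × Trajectory K)) :
      expect (obsKernel q₀ π o) (fun x => likelihoodRatio k s x.1 x.2) = 1 := by
    have h := expect_obsKernel_perturbed h₀ hs hq π o (g := fun _ => 1) (C := 1) (by simp)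
    simpa using h.symm
  have h2 := expect_abs_prod_sub_one_le (κ₀ := obsKernel q₀ π)
    (r := fun x => likelihoodRatio k s x.1 x.2) (abs_likelihoodRatio_le hs)
    (fun x => (likelihoodRatio_pos hs hs1 x).le) h1 t
  have h3 (o : List (Fin K × Trajectory K)) :
      expect (obsKernel q₀ π o) (fun x => |likelihoodRatio k s x.1 x.2 - 1|)
        = s * (stepProb K + (π o k).toReal / 2) := by
    rw [expect_obsKernel_likelihoodRatio (φ := fun y => |y - 1|) (C := s) h₀ hs (by simp)
      (fun y hy hy' => by rw [abs_abs, abs_le]; constructor <;> linarith)]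
    have e1 : |1 + s - 1| = s := by rw [add_sub_cancel_left, abs_of_nonneg hs]
    have e2 : |1 - s - 1| = s := by rw [sub_sub_cancel_left, abs_neg, abs_of_nonneg hs]
    rw [e1, e2]
    ring
  simp only [h3, expect_const_mul, ← Finset.mul_sum] at h2
  have h4 : expect (histLaw (obsKernel q₀ π) t) (fun o => |historyRatio k s o - 1|)
    ≤ s * expectedExits q₀ π t k := h2
  linarith

/-- The bound that is good for many epochs: relative entropies add up. -/
theorem expect_policy_sub_le_entropy (h₀ : ∀ e, (q₀ e : ℝ) = 1 / 2) (hs : 0 ≤ s) (hs1 : s < 1)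
    (hq : ∀ e, (q e : ℝ) = 1 / 2 + if e = (k, none) then s / 2 else 0) (π : Policy K) (t : ℕ)
    {c : ℝ} (hc : 0 < c) :
    expect (histLaw (obsKernel q π) t) (fun o => (π o k).toReal)
        - expect (histLaw (obsKernel q₀ π) t) (fun o => (π o k).toReal)
      ≤ c / 2 + -Real.log (1 - s ^ 2) / (8 * c) * expectedExits q₀ π t k := by
  refine (expect_policy_sub_le h₀ hs hq π t).trans ?_
  have hl (y : ℝ) (hy : 1 - s ≤ y) (hy' : y ≤ 1 + s) :
      |Real.log y| ≤ |Real.log (1 - s)| + |Real.log (1 + s)| := by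
    have h1 := Real.log_le_log (by linarith) hy
    have h2 := Real.log_le_log (by linarith) hy'
    rw [abs_le]
    constructor
    · linarith [neg_abs_le (Real.log (1 - s)), abs_nonneg (Real.log (1 + s))]
    · linarith [le_abs_self (Real.log (1 + s)), abs_nonneg (Real.log (1 - s))]
  have hlr (x : Fin K × Trajectory K) := hl _ (likelihoodRatio_mem (k := k) hs x.1 x.2).1
    (likelihoodRatio_mem (k := k) hs x.1 x.2).2
  have hlog : BddOn (histLaw (obsKernel q₀ π) t) fun o => Real.log (historyRatio k s o) := by
    simp only [log_historyRatio hs hs1]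
    exact (bddPerLength_sum hlr).bddOn _ t
  have h1 : expect (histLaw (obsKernel q₀ π) t) (fun o => |historyRatio k s o - 1|)
      ≤ c - expect (histLaw (obsKernel q₀ π) t) (fun o => Real.log (historyRatio k s o))
        / (2 * c) :=
    expect_abs_density_sub_one_le
      ((bddPerLength_prod (abs_likelihoodRatio_le hs)).bddOn _ t) (historyRatio_pos hs hs1) hlog
      (expect_historyRatio h₀ hs hq π t) hc
  have h2 : expect (histLaw (obsKernel q₀ π) t) (fun o => Real.log (historyRatio k s o))
      = Real.log (1 - s ^ 2) / 2 * expectedExits q₀ π t k := by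
    simp only [log_historyRatio hs hs1]
    rw [expect_sum_histLaw hlr]
    simp only [expect_obsKernel_likelihoodRatio (φ := Real.log) h₀ hs Real.log_one hl,
      expect_mul_const, ← Finset.sum_mul]
    have e : Real.log (1 - s ^ 2) = Real.log (1 + s) + Real.log (1 - s) := by
      rw [← Real.log_mul (by linarith) (by linarith)]
      congr 1
      ring
    rw [e, expectedExits]
    ring
  rw [h2] at h1
  have e : c / 2 + -Real.log (1 - s ^ 2) / (8 * c) * expectedExits q₀ π t k
      = (c - Real.log (1 - s ^ 2) / 2 * expectedExits q₀ π t k / (2 * c)) / 2 := by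
    field_simp
    ring
  rw [e]
  linarith

end

theorem sum_range_cast_le (T : ℕ) : ∑ t ∈ Finset.range T, (t : ℝ) ≤ (T : ℝ) ^ 2 / 2 := by
  induction T with
  | zero => simp
  | succ T ih =>
    rw [Finset.sum_range_succ]
    push_cast
    nlinarith

/-- On average over the instances, the perturbed node is played only a little more often than
every `K`-th epoch. -/
theorem sum_expectedPlays_perturbed_le {T : ℕ} (hK : 1 ≤ K) (hT : 0 < T)
    {q₀ : Fin K × Option (Fin K) → unitInterval}
    {q : Fin K → Fin K × Option (Fin K) → unitInterval} {s : ℝ}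
    (h₀ : ∀ e, (q₀ e : ℝ) = 1 / 2)
    (hq : ∀ k e, (q k e : ℝ) = 1 / 2 + if e = (k, none) then s / 2 else 0)
    (hs : 0 ≤ s) (hs1 : s < 1) (hsT : s ^ 2 * (2 * K * T) = ((K : ℝ) - 1) ^ 2) (π : Policy K) :
    ∑ k, expectedPlays (q k) π T k ≤ T + 7 / 25 * T * ((K : ℝ) - 1) := by
  -- A bound `a + b * expectedExits` for one epoch gives one for the sum over epochs and nodes.
  have key {a b : ℝ} (hb : 0 ≤ b)
      (h : ∀ k t, expect (histLaw (obsKernel (q k) π) t) (fun o => (π o k).toReal)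
        - expect (histLaw (obsKernel q₀ π) t) (fun o => (π o k).toReal)
          ≤ a + b * expectedExits q₀ π t k) :
      ∑ k, expectedPlays (q k) π T k ≤ T + (T * (K * a) + b * (T ^ 2 / 2)) := by
    have h1 (t : ℕ) : ∑ k, expect (histLaw (obsKernel (q k) π) t) (fun o => (π o k).toReal)
        ≤ 1 + (K * a + b * t) := by
      have h2 := Finset.sum_le_sum fun k (_ : k ∈ Finset.univ) => h k t
      rw [Finset.sum_sub_distrib, sum_expect_policy, Finset.sum_add_distrib, ← Finset.mul_sum,
        sum_expectedExits hK, Finset.sum_const, Finset.card_univ, Fintype.card_fin,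
        nsmul_eq_mul] at h2
      linarith
    have h3 := Finset.sum_le_sum fun t (_ : t ∈ Finset.range T) => h1 t
    rw [Finset.sum_add_distrib, Finset.sum_add_distrib, ← Finset.mul_sum, Finset.sum_const,
      Finset.sum_const, Finset.card_range, nsmul_eq_mul, nsmul_eq_mul, mul_one] at h3
    simp only [expectedPlays]
    rw [Finset.sum_comm]
    have h4 := mul_le_mul_of_nonneg_left (sum_range_cast_le T) hb
    rw [Finset.mul_sum] at h4
    linarith
  have hK' : (1 : ℝ) ≤ K := by exact_mod_cast hK
  have hT' : (0 : ℝ) < T := by exact_mod_cast hT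
  by_cases hcase : 2 * T ≤ 5 * K ∨ K = 1
  · have h := key (a := 0) (b := s / 2) (by positivity) fun k t => by
      rw [zero_add]
      exact expect_policy_sub_le_linear h₀ hs hs1 (hq k) π t
    have h2 : s * T ≤ 28 / 25 * ((K : ℝ) - 1) := by
      refine le_of_sq_le_sq ?_ (by linarith)
      rcases hcase with hcase | rfl
      · have h5 : 2 * (T : ℝ) ≤ 5 * K := by exact_mod_cast hcase
        have h6 : 2 * K * (s * T) ^ 2 = T * ((K : ℝ) - 1) ^ 2 := by
          rw [← hsT]
          ring
        have h7 : 2 * K * (s * T) ^ 2 ≤ 2 * K * (28 / 25 * ((K : ℝ) - 1)) ^ 2 := by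
          rw [h6]
          nlinarith [mul_nonneg (sub_nonneg.2 h5) (sq_nonneg ((K : ℝ) - 1)),
            mul_nonneg (by linarith : (0 : ℝ) ≤ K) (sq_nonneg ((K : ℝ) - 1))]
        exact le_of_mul_le_mul_left h7 (by linarith)
      · have h5 : s ^ 2 = 0 := by
          refine (mul_eq_zero.1 (hsT.trans (by norm_num))).resolve_right (by positivity)
        have h6 : s = 0 := by simpa using h5
        simp [h6]
    nlinarith
  · push Not at hcase
    have h5 : 5 * (K : ℝ) ≤ 2 * T := by exact_mod_cast hcase.1.le
    have h2K : (2 : ℝ) ≤ K := by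
      have : 2 ≤ K := by omega
      exact_mod_cast this
    have hs5 : s ^ 2 ≤ 1 / 5 := by
      have h6 : s ^ 2 * (5 * K * K) ≤ 1 / 5 * (5 * K * K) := by
        have h7 : s ^ 2 * (5 * K * K) ≤ s ^ 2 * (2 * K * T) :=
          mul_le_mul_of_nonneg_left (by nlinarith) (sq_nonneg s)
        nlinarith
      exact le_of_mul_le_mul_right h6 (by positivity)
    have hlog : -Real.log (1 - s ^ 2) ≤ 5 / 4 * s ^ 2 := by
      have h6 := Real.one_sub_inv_le_log_of_pos (show 0 < 1 - s ^ 2 by linarith)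
      have h7 : (1 - s ^ 2)⁻¹ ≤ 1 + 5 / 4 * s ^ 2 := by
        rw [inv_le_iff_one_le_mul₀ (by linarith)]
        nlinarith [sq_nonneg s]
      linarith
    -- Close to the value that minimizes the sum of the two terms of the bound.
    let c : ℝ := 7 / 25 * (((K : ℝ) - 1) / K)
    have hc : 0 < c := by
      have : 0 < (K : ℝ) - 1 := by linarith
      positivity
    have hlog0 : 0 ≤ -Real.log (1 - s ^ 2) := by
      have := Real.log_nonpos (by linarith : 0 ≤ 1 - s ^ 2) (by linarith [sq_nonneg s])
      linarith
    have h := key (a := c / 2) (b := -Real.log (1 - s ^ 2) / (8 * c)) (by positivity) fun k t =>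
      expect_policy_sub_le_entropy h₀ hs hs1 (hq k) π t hc
    have h8 : -Real.log (1 - s ^ 2) / (8 * c) * ((T : ℝ) ^ 2 / 2)
        ≤ 5 / 4 * s ^ 2 / (8 * c) * ((T : ℝ) ^ 2 / 2) := by gcongr
    have h9 : 5 / 4 * s ^ 2 / (8 * c) * ((T : ℝ) ^ 2 / 2) = 125 / 896 * T * ((K : ℝ) - 1) := by
      have hs2 : s ^ 2 = ((K : ℝ) - 1) ^ 2 / (2 * K * T) := by
        rw [← hsT]
        field_simp
      have hK1 : (K : ℝ) - 1 ≠ 0 := by linarith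
      simp only [c, hs2]
      field_simp
      norm_num
    have h10 : K * (c / 2) = 7 / 50 * ((K : ℝ) - 1) := by
      simp only [c]
      field_simp
      ring
    rw [h10] at h
    have h11 : 0 ≤ (T : ℝ) * ((K : ℝ) - 1) := mul_nonneg hT'.le (by linarith)
    nlinarith

/-! ### The perturbed instances -/

section

variable {T : ℕ} (hK : 1 ≤ K) (hKT : K ≤ 2 * T + 1)

theorem perturbation_div_eq (K T : ℕ) (hK : 1 ≤ K) :
    perturbation K T / (1 - K * stepProb K) = 4 * perturbation K T / 2 := by
  rw [stepProb_mul_self (⟨0, hK⟩ : Fin K)]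
  ring

theorem instanceParam_none (e : Fin K × Option (Fin K)) :
    (instanceParam K T hK hKT none e : ℝ) = 1 / 2 := by
  simp [instanceParam]

theorem instanceParam_some (k : Fin K) (e : Fin K × Option (Fin K)) :
    (instanceParam K T hK hKT (some k) e : ℝ)
      = 1 / 2 + if e = (k, none) then 4 * perturbation K T / 2 else 0 := by
  obtain ⟨i, x⟩ := e
  rw [← perturbation_div_eq K T hK]
  by_cases h : i = k ∧ x = none
  · obtain ⟨rfl, rfl⟩ := h
    simp [instanceParam]
  · have h' : ¬((some k : Option (Fin K)) = some i ∧ x = none) := by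
      rintro ⟨h1, h2⟩
      exact h ⟨(Option.some.inj h1).symm, h2⟩
    have h'' : (i, x) ≠ (k, none) := fun e => h (Prod.mk.inj e)
    rw [instanceParam, if_neg h', if_neg h'']
    simp

end

theorem perturbation_mul (K T : ℕ) :
    perturbation K T * T = 1 / (4 * √2) * (((K : ℝ) - 1) / K) * √((K : ℝ) * T) := by
  have h : √((K : ℝ) / T) * T = √((K : ℝ) * T) := by
    rcases Nat.eq_zero_or_pos T with rfl | hT
    · simp
    have hT' : (0 : ℝ) < T := by exact_mod_cast hT
    have e : (K : ℝ) * T = K / T * T ^ 2 := by field_simp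
    rw [e, Real.sqrt_mul (by positivity), Real.sqrt_sq hT'.le]
  rw [perturbation, mul_assoc, h]

theorem sq_four_mul_perturbation_mul {K T : ℕ} (hK : 1 ≤ K) (hT : 0 < T) :
    (4 * perturbation K T) ^ 2 * (2 * K * T) = ((K : ℝ) - 1) ^ 2 := by
  have hK' : (0 : ℝ) < K := by exact_mod_cast hK
  have hT' : (0 : ℝ) < T := by exact_mod_cast hT
  unfold perturbation
  rw [mul_pow, mul_pow, mul_pow, div_pow, div_pow, mul_pow, Real.sq_sqrt (by norm_num),
    Real.sq_sqrt (by positivity)]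
  field_simp

theorem four_mul_perturbation_lt_one {K T : ℕ} (hK : 1 ≤ K) (hKT : K ≤ 2 * T + 1) (hT : 0 < T) :
    4 * perturbation K T < 1 := by
  have hK' : (1 : ℝ) ≤ K := by exact_mod_cast hK
  have hT' : (0 : ℝ) < T := by exact_mod_cast hT
  have hKT' : (K : ℝ) ≤ 2 * T + 1 := by exact_mod_cast hKT
  by_contra! h
  have h1 := sq_four_mul_perturbation_mul hK hT
  have h2 : 1 ≤ (4 * perturbation K T) ^ 2 := one_le_pow₀ h
  have h3 : (0 : ℝ) < 2 * K * T := by positivity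
  nlinarith

/-- In some instance, the perturbed node is played in a fraction of the epochs that is bounded
away from `1`. -/
theorem exists_expectedPlays_le {K T : ℕ} (hK : 1 ≤ K) (hKT : K ≤ 2 * T + 1) (π : Policy K) :
    ∃ k : Fin K, 18 / 25 * (((K : ℝ) - 1) / K) * T
      ≤ T - expectedPlays (instanceParam K T hK hKT (some k)) π T k := by
  have hK' : (0 : ℝ) < K := by exact_mod_cast hK
  rcases Nat.eq_zero_or_pos T with rfl | hT
  · exact ⟨⟨0, hK⟩, by simp [expectedPlays]⟩
  have h := sum_expectedPlays_perturbed_le hK hT (instanceParam_none hK hKT)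
    (instanceParam_some hK hKT) (by linarith [perturbation_nonneg K T hK])
    (four_mul_perturbation_lt_one hK hKT hT) (sq_four_mul_perturbation_mul hK hT) π
  have hne : (Finset.univ : Finset (Fin K)).Nonempty := ⟨⟨0, hK⟩, Finset.mem_univ _⟩
  have hsum : ∑ k : Fin K, expectedPlays (instanceParam K T hK hKT (some k)) π T k
      ≤ ∑ _k : Fin K, ((T : ℝ) - 18 / 25 * (((K : ℝ) - 1) / K) * T) := by
    refine h.trans (le_of_eq ?_)
    rw [Finset.sum_const, Finset.card_univ, Fintype.card_fin, nsmul_eq_mul]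
    field_simp
    ring
  obtain ⟨k, -, hk⟩ := Finset.exists_le_of_sum_le hne hsum
  exact ⟨k, by linarith⟩

end RandomWalkBandit

theorem mainTheorem1 (K T : ℕ) (hK : 1 ≤ K) (hKT : K ≤ 2 * T + 1)
    (π : RandomWalkBandit.Policy K) :
    ∃ k : Fin K,
      Summable (fun h : List (RandomWalkBandit.Epoch K) =>
        (RandomWalkBandit.law (RandomWalkBandit.instanceParam K T hK hKT (some k)) π T h).toReal *
          RandomWalkBandit.regret k h) ∧
      1 / (8 * √2) * (((K : ℝ) - 1) / K) ^ 2 * √((K : ℝ) * T) ≤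
        RandomWalkBandit.expectedRegret
          (RandomWalkBandit.instanceParam K T hK hKT (some k)) π T k ∧
      (6 ≤ K → 1 / (8 * √2) * √((K : ℝ) * T) ≤
        RandomWalkBandit.expectedRegret
          (RandomWalkBandit.instanceParam K T hK hKT (some k)) π T k) := by
  obtain ⟨k, hk⟩ := RandomWalkBandit.exists_expectedPlays_le hK hKT π
  have hK' : (1 : ℝ) ≤ K := by exact_mod_cast hK
  have hreg : 18 / 25 * (((K : ℝ) - 1) / K) ^ 2 * (1 / (4 * √2) * √((K : ℝ) * T))
      ≤ RandomWalkBandit.expectedRegret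
        (RandomWalkBandit.instanceParam K T hK hKT (some k)) π T k := by
    rw [RandomWalkBandit.expectedRegret_eq (RandomWalkBandit.instanceParam_some hK hKT k),
      mul_div_cancel_left₀ _ (four_ne_zero' ℝ)]
    refine le_trans (le_of_eq ?_) (mul_le_mul_of_nonneg_left hk
      (RandomWalkBandit.perturbation_nonneg K T hK))
    linear_combination (-(18 / 25 * (((K : ℝ) - 1) / K))) *
      RandomWalkBandit.perturbation_mul K T
  have hR : 0 ≤ 1 / (4 * √2) * √((K : ℝ) * T) := by positivity
  have e : 1 / (8 * √2) = 1 / 2 * (1 / (4 * √2)) := by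
    rw [show (8 : ℝ) * √2 = 2 * (4 * √2) by ring, one_div_mul_one_div]
  refine ⟨k, RandomWalkBandit.summable_regret _ π T k, le_trans ?_ hreg, fun h6 =>
    le_trans ?_ hreg⟩
  · have h := mul_nonneg (sq_nonneg (((K : ℝ) - 1) / K)) hR
    rw [e]
    linarith
  · -- This is where `6 ≤ K` enters: `18 / 25 * (5 / 6) ^ 2 = 1 / 2`.
    have h6' : (6 : ℝ) ≤ K := by exact_mod_cast h6
    have h56 : 5 / 6 ≤ ((K : ℝ) - 1) / K := by
      rw [le_div_iff₀ (by linarith)]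
      linarith
    have hsq : 1 / 2 ≤ 18 / 25 * (((K : ℝ) - 1) / K) ^ 2 := by nlinarith
    have h := mul_le_mul_of_nonneg_right hsq hR
    rw [e]
    linarith
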